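/- Let $a\in\mathbb N=\{0,1,2,\dots\}$. Given elements $b,c,d,\lambda$ of a commutative ring (real numbers or indeterminates, as specified in each part), let $[T_{n,k}]_{n,k\ge 0}$ be the lower-triangular array with $T_{0,0}=1$, $T_{n,k}=0$ for $k>n$, and $$T_{n,k}=c\,T_{n-1,k-1}+\bigl[ab(n-1)+bk+abd+c\lambda\bigr]T_{n-1,k}+b\lambda(k+1)\,T_{n-1,k+1}\qquad(n\ge 1,\ k\ge 0),$$ where $T_{n-1,-1}=0$ (the generalized Lah triangle). Let $T_n(q)=\sum_{k=0}^n T_{n,k}q^k$. Terminology. For a set $\mathbf x$ of indeterminates, an infinite matrix over $\mathbb R[\mathbf x]$ is $\mathbf x$-TP if all its minors are polynomials with nonnegative coefficients; a sequence $(\alpha_n)_{n\ge0}$ in $\mathbb R[\mathbf x]$ is $\mathbf x$-SM if its Hankel matrix $[\alpha_{i+j}]_{i,j\ge0}$ is $\mathbf x$-TP, and is $3$-$\mathbf x$-log-convex if $\mathcal L^m[\alpha_i]$ has nonnegative coefficients for all $m\le 3$ and all $i\geq m$, where $\mathcal L[\alpha_i]=\alpha_{i-1}\alpha_{i+1}-\alpha_i^2$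 and $\mathcal L^m=\mathcal L(\mathcal L^{m-1})$. A real sequence $(\alpha_n)_{n\ge 0}$ is SM if $\alpha_n=\int_0^\infty x^n\,d\mu(x)$ for all $n\ge0$, for some nonnegative measure $\mu$ on $[0,\infty)$ with finite moments. A real sequence is PF if all minors of its Toeplitz matrix $[\alpha_{i-j}]_{i,j\ge0}$ are nonnegative (with $\alpha_n=0$ outside its index range). Write $(x)_n=x(x-1)\cdots(x-n+1)$. Then the following hold. (i) For real $b,c,d,\lambda$ and all $n,k\ge0$, $$T_{n,k}=\frac{a^n}{k!}\sum_{j\ge0}\sum_{i=0}^{k+j}\frac{(-1)^{n+k+j-i}\,b^{n-k-j}c^{k+j}\lambda^j}{j!}\binom{k+j}{i}\Bigl(-\frac{i+ad}{a}\Bigr)_n .$$ Here, for $a=0$, the product $a^n\bigl(-\frac{i+ad}{a}\bigr)_n=\prod_{r=0}^{n-1}(-(i+ad)-ra)$ is read as $(-i)^n$ (with $0^0=1$). For $k+j>n$ the inner sum over $i$ vanishes, so these terms are $0$, also when $b=0$. (ii) For $d\in\mathbb N$ and real $c>0$, with $b,\lambda$ indeterminates, $[T_{n,k}]_{n,k\ge0}$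 is $(b,\lambda)$-TP. (iii) For $c=b$, with $b,d,\lambda$ indeterminates, $[T_{n,k}]_{n,k\ge0}$ is $(b,d,\lambda)$-TP. (iv) For $c=b$, with $b,d,\lambda,q$ indeterminates, $(T_n(q))_{n\ge0}$ is $(b,d,\lambda,q)$-SM and $3$-$(b,d,\lambda,q)$-log-convex. In particular, $(T_{n,0})_{n\ge0}$ is $(b,d,\lambda)$-SM and $3$-$(b,d,\lambda)$-log-convex. (v) For real $b>0$, the sequence $(f_n)_{n\ge1}$ given by $\sum_{n\ge1}f_n\frac{t^n}{n!}=\frac{(1-abt)^{-1/a}-1}{b}$ (read as its limit $\frac{e^{bt}-1}{b}$ if $a=0$) is SM, i.e. $(f_{n+1})_{n\ge0}$ is SM. (vi) Let $c=b$ and let $b,d,\lambda\ge0$ be real. If $(x_n)_{n\ge0}$ and $(y_n)_{n\ge0}$ are SM, then so is $z_n=\sum_{k=0}^n T_{n,k}x_ky_{n-k}$. (vii) Let $m=a+1$, $d=0$, and let $b,c,\lambda$ be real. In $\mathbb R[q][[t]]$, $$\sum_{n\ge0}T_n(q)t^n=\cfrac{1}{1-\alpha_m t\prod\limits_{i_1=1}^m\cfrac{1}{1-\alpha_{m+i_1}t\prod\limits_{i_2=1}^m\cfrac{1}{1-\alpha_{m+i_1+i_2}t\prod\limits_{i_3=1}^m\cfrac{1}{1-\cdots}}}}$$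 with $(\alpha_i)_{i\ge m}=(c(q+\lambda),\underbrace{b,\dots,b}_{m},c(q+\lambda),\underbrace{2b,\dots,2b}_{m},c(q+\lambda),\underbrace{3b,\dots,3b}_{m},\dots)$; the infinite fraction is the coefficientwise limit of its truncations. In particular, $\sum_{n\ge0}T_{n,0}t^n$ has the same type of expansion in $\mathbb R[[t]]$, with $c(q+\lambda)$ replaced by $c\lambda$. (viii) For real $b,c,d,\lambda\ge0$ and every $n$, the row $(T_{n,k})_{k=0}^n$ is a PF sequence, and $T_n(q)$, unless identically zero, has only real zeros. -/

import Mathlib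

open Finset

/-- `T` is the generalized Lah triangle with parameters `a, b, c, d, l`, over any commutative ring:
the lower triangular array with `T 0 0 = 1` and
`T_{n,k} = c T_{n-1,k-1} + [ab(n-1) + bk + abd + cl] T_{n-1,k} + bl(k+1) T_{n-1,k+1}`
for `n ≥ 1`, `k ≥ 0`, where `T_{n-1,-1} = 0`. -/
structure IsGenLahTriangle {R : Type*} [CommRing R] (a : ℕ) (b c d l : R) (T : ℕ → ℕ → R) :
    Prop where
  init : T 0 0 = 1
  lower : ∀ n k, n < k → T n k = 0
  rec_zero : ∀ n : ℕ,
    T (n + 1) 0 = (a * b * n + a * b * d + c * l) * T n 0 + b * l * T n 1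
  rec_succ : ∀ n k : ℕ,
    T (n + 1) (k + 1) = c * T n k
      + (a * b * n + b * ((k + 1 : ℕ) : R) + a * b * d + c * l) * T n (k + 1)
      + b * l * ((k + 2 : ℕ) : R) * T n (k + 2)

/-- The row-generating polynomial `T_n(q) = ∑_{k ≤ n} T_{n,k} q^k`. -/
noncomputable def rowPoly {R : Type*} [CommRing R] (T : ℕ → ℕ → R) (n : ℕ) : Polynomial R :=
  ∑ k ∈ range (n + 1), Polynomial.C (T n k) * Polynomial.X ^ k

/-- A polynomial all of whose coefficients are nonnegative. -/
def NonnegCoeffs {σ : Type*} (p : MvPolynomial σ ℝ) : Prop :=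
  ∀ e : σ →₀ ℕ, 0 ≤ p.coeff e

/-- An infinite matrix is totally positive: all minors are nonnegative. -/
def IsTP (M : ℕ → ℕ → ℝ) : Prop :=
  ∀ (r : ℕ) (rows cols : Fin r → ℕ), StrictMono rows → StrictMono cols →
    0 ≤ (Matrix.of fun i j => M (rows i) (cols j)).det

/-- An infinite matrix over `ℝ[x]` is `x`-totally positive: all minors have nonnegative
coefficients in the indeterminates `x = (x_s)_{s ∈ σ}`. -/
def IsXTP {σ : Type*} (M : ℕ → ℕ → MvPolynomial σ ℝ) : Prop :=
  ∀ (r : ℕ) (rows cols : Fin r → ℕ), StrictMono rows → StrictMono cols →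
    NonnegCoeffs (Matrix.of fun i j => M (rows i) (cols j)).det

/-- An `x`-Stieltjes moment sequence: its Hankel matrix is `x`-totally positive. -/
def IsXSM {σ : Type*} (α : ℕ → MvPolynomial σ ℝ) : Prop :=
  IsXTP fun i j => α (i + j)

/-- The operator `ℒ[α_i] = α_{i-1} α_{i+1} - α_i ^ 2`, re-indexed so that the result again starts
at index `0`. -/
def logConvexOp {R : Type*} [CommRing R] (α : ℕ → R) : ℕ → R :=
  fun i => α i * α (i + 2) - α (i + 1) ^ 2

/-- `k`-`x`-log-convexity: `ℒ^m[α_i]` has nonnegative coefficients for all `m ≤ k`. -/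
def IsXLogConvexOfOrder {σ : Type*} (k : ℕ) (α : ℕ → MvPolynomial σ ℝ) : Prop :=
  ∀ m ≤ k, ∀ i, NonnegCoeffs (logConvexOp^[m] α i)

/-- A real Stieltjes moment sequence: `α_k = ∫ x^k dμ` for a nonnegative measure `μ` on `[0, ∞)`
with finite moments. -/
def IsStieltjesMoment (α : ℕ → ℝ) : Prop :=
  ∃ μ : MeasureTheory.Measure ℝ, μ (Set.Iio 0) = 0 ∧
    ∀ k : ℕ, MeasureTheory.Integrable (fun x : ℝ => x ^ k) μ ∧ α k = ∫ x, x ^ k ∂μ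

/-- The convolution `z_n = ∑_{k ≤ n} A_{n,k} x_k y_{n-k}` preserves Stieltjes moment sequences. -/
def PreservesSM (A : ℕ → ℕ → ℝ) : Prop :=
  ∀ x y : ℕ → ℝ, IsStieltjesMoment x → IsStieltjesMoment y →
    IsStieltjesMoment fun n => ∑ k ∈ range (n + 1), A n k * x k * y (n - k)

/-- A Pólya frequency sequence: its Toeplitz matrix `[α_{i-j}]` is totally positive. -/
def IsPF (α : ℕ → ℝ) : Prop :=
  IsTP fun i j => if j ≤ i then α (i - j) else 0

/-- Truncation at depth `N` of the `m`-branched Stieltjes-type continued fraction whose topmost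
coefficient is `α (k + m)`:
`F_0(k) = 1` and `F_{N+1}(k) = 1 / (1 - α_{k+m} t ∏_{i=1}^m F_N(k+i))`. -/
noncomputable def branchedTrunc {R : Type*} [CommRing R] (m : ℕ) (α : ℕ → R) :
    ℕ → ℕ → PowerSeries R
  | 0, _ => 1
  | N + 1, k =>
      PowerSeries.invOfUnit
        (1 - PowerSeries.C (α (k + m)) * PowerSeries.X *
          ∏ i ∈ Icc 1 m, branchedTrunc m α N (k + i)) 1

/-- `F` is the value of the `m`-branched Stieltjes-type continued fraction with coefficients
`(α_i)_{i ≥ m}`: the truncations converge to `F` coefficientwise (each coefficient is eventually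
constant). -/
def IsBranchedSFraction {R : Type*} [CommRing R] (m : ℕ) (α : ℕ → R) (F : PowerSeries R) :
    Prop :=
  ∀ n : ℕ, ∃ N₀ : ℕ, ∀ N ≥ N₀,
    PowerSeries.coeff n (branchedTrunc m α N 0) = PowerSeries.coeff n F

/-- The sequence `(α_i)_{i ≥ m} = (u, b, …, b, u, 2b, …, 2b, u, 3b, …, 3b, u, …)` with blocks of
length `m`; its values at `i < m` are irrelevant. -/
def branchedCoeffs {R : Type*} [CommRing R] (m : ℕ) (u b : R) (i : ℕ) : R :=
  if (i - m) % (m + 1) = 0 then u else (((i - m) / (m + 1) + 1 : ℕ) : R) * b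

/-! Let `L_n` be the row polynomial, `D` the derivative, `Y` multiplication by `c(X + l)`, and `E =
1 + uD` with `u c = b`. The defining recurrence reads `L_{n+1} = (abn + abd + YE) L_n`. Since `EY =
YE + b`, the dependence on `n` can be traded for a power of `E`: `L_{n+1} = (abd + YE) E^a L_n`
(`genLahPoly_succ_eq_lahProd`). The matrix of this fixed operator is built from bidiagonal matrices
by products and by adding a scalar to the tridiagonal `YE`, so its minors lie in every subsemiring
containing `u, c, d, l`. Cauchy–Binet carries this over to the triangle and to the Hankel matrix of
its column 0. The semiring of polynomials with nonnegative coefficients gives (ii)–(iv): `X` and `l`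
enter only through `X + l`, so `T_n(q)` is column 0 for the parameter `l + q`, and iterated
log-convexity reduces to Hankel minors.

Parts (i) and (vi) rest on one identity: for `c = b`, `l = 0`, the functional `X^j ↦ (x)_j` sends
`L_n` to `∏_{r<n} (bx + abr + abd)`. Finite differences in `x` recover the coefficients, which is
(i). A Poisson variable of mean `y` has factorial moments `y^j`, so `L_n(y)` is a Poisson mixture of
rising products, and these are moments of scaled gamma laws or point masses. Mixing further over the
two given measures yields (vi); in (v) the sequence is a single rising product.

For (vii), coefficients of `E^r L_n` collected along diagonals form power series with an Euler–Gauss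
recurrence. For (viii), the case `l = 0` goes by induction on `n`: at a nonreal zero of the next
polynomial, the imaginary part of `z p'(z)/p(z)` would have the wrong sign. Translation by `l` keeps
zeros nonpositive, and linear factors `X + s` with `s ≥ 0` have totally positive Toeplitz matrices.
-/

/-- All minors of the infinite matrix `M` lie in the subsemiring `N`. -/
def MinorsMem {R : Type*} [CommRing R] (N : Subsemiring R) (M : ℕ → ℕ → R) : Prop :=
  ∀ (r : ℕ) (rows cols : Fin r → ℕ), StrictMono rows → StrictMono cols →
    (Matrix.of fun i j => M (rows i) (cols j)).det ∈ N

/-! ### Minors in a subsemiring: Cauchy–Binet, production matrices, tridiagonal matrices -/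

section Minors

variable {R : Type*} [CommRing R] {N : Subsemiring R}

/-- A form of the Cauchy–Binet formula: if all maximal minors of two factors lie in a subsemiring,
then so does the determinant of their product. -/
theorem det_mem_of_eq_sum {r : ℕ} (K : ℕ) {M : Matrix (Fin r) (Fin r) R}
    {A : Fin r → ℕ → R} {B : ℕ → Fin r → R} (h : ∀ i j, M i j = ∑ k ∈ range K, A i k * B k j)
    (hA : ∀ κ : Fin r → ℕ, StrictMono κ → (Matrix.of fun i j => A i (κ j)).det ∈ N)
    (hB : ∀ κ : Fin r → ℕ, StrictMono κ → (Matrix.of fun i j => B (κ i) j).det ∈ N) :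
    M.det ∈ N := by
  classical
  -- Multilinear expansion over all column choices `p`. A repeated choice gives two equal columns;
  -- the injective ones are grouped by their image `s`, and each group runs over the permutations of
  -- the increasing enumeration `κ` of `s`.
  have h1 : M.det = ∑ p ∈ Fintype.piFinset (fun _ : Fin r => range K),
      (∏ i, B (p i) i) * (Matrix.of fun i j => A i (p j)).det := by
    simp only [Matrix.det_apply', h, prod_univ_sum, mul_sum, Matrix.of_apply, prod_mul_distrib]
    rw [Finset.sum_comm]
    exact sum_congr rfl fun p _ => sum_congr rfl fun σ _ => by ring
  have h2 : M.det = ∑ p ∈ (Fintype.piFinset (fun _ : Fin r => range K)).filter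
      Function.Injective, (∏ i, B (p i) i) * (Matrix.of fun i j => A i (p j)).det := by
    rw [h1]
    refine (sum_subset (filter_subset _ _) fun p hp hpi => ?_).symm
    have hni : ¬ Function.Injective p := fun hh => hpi (mem_filter.2 ⟨hp, hh⟩)
    simp only [Function.Injective, not_forall] at hni
    obtain ⟨i, j, hij, hne⟩ := hni
    rw [Matrix.det_zero_of_column_eq hne (fun k => by simp [hij]), mul_zero]
  have hmaps : ∀ p ∈ (Fintype.piFinset (fun _ : Fin r => range K)).filter Function.Injective,
      univ.image p ∈ (range K).powersetCard r := by
    intro p hp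
    rw [mem_filter, Fintype.mem_piFinset] at hp
    rw [mem_powersetCard]
    refine ⟨fun x hx => ?_, ?_⟩
    · obtain ⟨i, -, rfl⟩ := mem_image.1 hx
      exact hp.1 i
    · rw [card_image_of_injective _ hp.2, card_univ, Fintype.card_fin]
  rw [h2, ← sum_fiberwise_of_maps_to hmaps]
  refine sum_mem fun s hs => ?_
  rw [mem_powersetCard] at hs
  let κ := s.orderEmbOfFin hs.2
  have hκ : ∀ i, κ i ∈ s := fun i => s.orderEmbOfFin_mem hs.2 i
  have h3 : ∑ p ∈ ((Fintype.piFinset (fun _ : Fin r => range K)).filter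
      Function.Injective).filter (fun p => univ.image p = s),
      (∏ i, B (p i) i) * (Matrix.of fun i j => A i (p j)).det
      = ∑ τ : Equiv.Perm (Fin r), (∏ i, B (κ (τ i)) i) *
        (Matrix.of fun i j => A i (κ (τ j))).det := by
    symm
    refine sum_bij (fun τ _ i => κ (τ i)) ?_ ?_ ?_ ?_
    · intro τ _
      simp only [mem_filter, Fintype.mem_piFinset]
      refine ⟨⟨fun i => hs.1 (hκ _), fun i j hij => τ.injective (κ.injective hij)⟩, ?_⟩
      refine eq_of_subset_of_card_le (fun x hx => ?_) ?_
      · obtain ⟨i, -, rfl⟩ := mem_image.1 hx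
        exact hκ _
      · rw [card_image_of_injective _ (fun i j hij => τ.injective (κ.injective hij)),
          card_univ, Fintype.card_fin, hs.2]
    · intro τ _ τ' _ hh
      exact Equiv.ext fun i => κ.injective (congrFun hh i)
    · intro p hp
      simp only [mem_filter] at hp
      have hps : ∀ i, p i ∈ s := fun i => hp.2 ▸ mem_image_of_mem p (mem_univ i)
      have hinj : Function.Injective fun i => (s.orderIsoOfFin hs.2).symm ⟨p i, hps i⟩ := by
        intro i j hij
        have := (s.orderIsoOfFin hs.2).symm.injective hij
        exact hp.1.2 (by simpa using this)
      refine ⟨Equiv.ofBijective _ (Finite.injective_iff_bijective.1 hinj), mem_univ _, ?_⟩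
      funext i
      change ((s.orderIsoOfFin hs.2) ((s.orderIsoOfFin hs.2).symm ⟨p i, hps i⟩) : ℕ) = p i
      rw [OrderIso.apply_symm_apply]
    · intro τ _
      rfl
  have h4 : ∀ τ : Equiv.Perm (Fin r), (Matrix.of fun i j => A i (κ (τ j))).det
      = (Equiv.Perm.sign τ : ℤ) * (Matrix.of fun i j => A i (κ j)).det := fun τ => by
    rw [← Matrix.det_permute']
    rfl
  rw [h3]
  have h5 : ∑ τ : Equiv.Perm (Fin r), (∏ i, B (κ (τ i)) i) *
        (Matrix.of fun i j => A i (κ (τ j))).det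
      = (Matrix.of fun i j => B (κ i) j).det * (Matrix.of fun i j => A i (κ j)).det := by
    rw [Matrix.det_apply' (Matrix.of fun i j => B (κ i) j), sum_mul]
    refine sum_congr rfl fun τ _ => ?_
    rw [h4]
    simp only [Matrix.of_apply]
    ring
  rw [h5]
  exact N.mul_mem (hB _ κ.strictMono) (hA _ κ.strictMono)

theorem MinorsMem.transpose {M : ℕ → ℕ → R} (h : MinorsMem N M) :
    MinorsMem N fun i j => M j i := by
  intro r rows cols hr hc
  rw [← Matrix.det_transpose]
  exact h r cols rows hc hr

theorem MinorsMem.apply {M : ℕ → ℕ → R} (h : MinorsMem N M) (i j : ℕ) : M i j ∈ N := by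
  have := h 1 (fun _ => i) (fun _ => j) (Subsingleton.strictMono _) (Subsingleton.strictMono _)
  simpa [Matrix.det_fin_one] using this

/-- A row-finite product of matrices with minors in `N` has its minors in `N`. -/
theorem MinorsMem.mul {M A B : ℕ → ℕ → R} (hA : MinorsMem N A) (hB : MinorsMem N B)
    (h : ∀ i, ∃ K₀, ∀ K ≥ K₀, ∀ j, M i j = ∑ k ∈ range K, A i k * B k j) : MinorsMem N M := by
  intro r rows cols hr hc
  choose K₀ hK using h
  refine det_mem_of_eq_sum (∑ i, K₀ (rows i)) (A := fun i k => A (rows i) k)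
    (B := fun k j => B k (cols j)) (fun i j => ?_) (fun κ hκ => hA r rows κ hr hκ)
    (fun κ hκ => hB r κ cols hκ hc)
  exact hK _ _ (single_le_sum (f := fun i => K₀ (rows i)) (fun _ _ => Nat.zero_le _) (mem_univ i)) _

/-- A matrix whose zeroth row is a unit vector and whose row `n + 1` is row `n` multiplied by a
matrix with minors in `N` has its minors in `N`. -/
theorem MinorsMem.of_production {M P : ℕ → ℕ → R} (hP : MinorsMem N P) (h0 : M 0 0 = 1)
    (h0' : ∀ k, 0 < k → M 0 k = 0)
    (h : ∀ n k, ∃ K₀, ∀ K ≥ K₀, M (n + 1) k = ∑ l ∈ range K, M n l * P l k) :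
    MinorsMem N M := by
  choose K₀ hK using h
  have key : ∀ n : ℕ, ∀ (r : ℕ) (rows cols : Fin r → ℕ), StrictMono rows → StrictMono cols →
      (∀ i, rows i < n) → (Matrix.of fun i j => M (rows i) (cols j)).det ∈ N := by
    intro n
    induction n with
    | zero =>
      intro r rows cols hr hc hb
      rcases r with _ | r
      · rw [Matrix.det_fin_zero]
        exact N.one_mem
      · exact absurd (hb 0) (Nat.not_lt_zero _)
    | succ n ih =>
      -- If row 0 is not used, every row is an earlier row times `P`, and Cauchy–Binet applies. If
      -- row 0 is used, it is a unit vector: expansion along it either leaves a minor of this kind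
      -- or gives zero.
      have pos : ∀ (r : ℕ) (rows cols : Fin r → ℕ), StrictMono rows → StrictMono cols →
          (∀ i, rows i < n + 1) → (∀ i, 0 < rows i) →
          (Matrix.of fun i j => M (rows i) (cols j)).det ∈ N := by
        intro r rows cols hr hc hb hpos
        have hr' : StrictMono fun i => rows i - 1 := fun i j hij => by
          have := hr hij
          have := hpos i
          dsimp only
          omega
        refine det_mem_of_eq_sum (∑ i, ∑ j, K₀ (rows i - 1) (cols j))
          (A := fun i k => M (rows i - 1) k) (B := fun k j => P k (cols j)) (fun i j => ?_)
          (fun κ hκ => ih r _ κ hr' hκ fun i => show rows i - 1 < n by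
            have := hb i; have := hpos i; omega)
          (fun κ hκ => hP r κ cols hκ hc)
        rw [← hK (rows i - 1) (cols j), Nat.sub_add_cancel (hpos i), Matrix.of_apply]
        refine le_trans ?_ (single_le_sum (f := fun i => ∑ j, K₀ (rows i - 1) (cols j))
          (fun _ _ => Nat.zero_le _) (mem_univ i))
        exact single_le_sum (f := fun j => K₀ (rows i - 1) (cols j))
          (fun _ _ => Nat.zero_le _) (mem_univ j)
      intro r rows cols hr hc hb
      rcases r with _ | r
      · rw [Matrix.det_fin_zero]
        exact N.one_mem
      by_cases hr0 : rows 0 = 0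
      · by_cases hc0 : cols 0 = 0
        · rw [Matrix.det_succ_row_zero, sum_eq_single 0]
          · simp only [Fin.val_zero, pow_zero, Matrix.of_apply, hr0, hc0, h0, one_mul]
            refine pos r (fun i => rows i.succ) (fun j => cols j.succ)
              (hr.comp Fin.strictMono_succ) (hc.comp Fin.strictMono_succ) (fun i => hb _)
              fun i => ?_
            rw [← hr0]
            exact hr (Fin.succ_pos i)
          · intro j _ hj
            have : 0 < cols j := hc0 ▸ hc (Fin.pos_of_ne_zero hj)
            simp [hr0, h0' _ this]
          · simp
        · rw [Matrix.det_eq_zero_of_row_eq_zero 0]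
          · exact N.zero_mem
          · intro j
            have : 0 < cols j :=
              lt_of_lt_of_le (Nat.pos_of_ne_zero hc0) (hc.monotone (Fin.zero_le j))
            simp [hr0, h0' _ this]
      · exact pos _ _ _ hr hc hb fun i =>
          lt_of_lt_of_le (Nat.pos_of_ne_zero hr0) (hr.monotone (Fin.zero_le i))
  intro r rows cols hr hc
  exact key (∑ i, rows i + 1) r rows cols hr hc fun i => Nat.lt_succ_of_le
    (single_le_sum (f := rows) (fun _ _ => Nat.zero_le _) (mem_univ i))

/-- An upper bidiagonal matrix with entries in `N` has its minors in `N`. -/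
theorem MinorsMem.of_bidiagonal {M : ℕ → ℕ → R} (hN : ∀ i j, M i j ∈ N)
    (h : ∀ i j, j ≠ i → j ≠ i + 1 → M i j = 0) : MinorsMem N M := by
  intro r
  induction r with
  | zero =>
    intro rows cols _ _
    rw [Matrix.det_fin_zero]
    exact N.one_mem
  | succ r ih =>
    intro rows cols hr hc
    have ih' := ih (fun i => rows i.succ) (fun j => cols j.succ)
      (hr.comp Fin.strictMono_succ) (hc.comp Fin.strictMono_succ)
    have hrpos : ∀ i : Fin (r + 1), i ≠ 0 → rows 0 < rows i :=
      fun i hi => hr (Fin.pos_of_ne_zero hi)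
    have hcpos : ∀ i : Fin (r + 1), i ≠ 0 → cols 0 < cols i :=
      fun i hi => hc (Fin.pos_of_ne_zero hi)
    -- In the first case only the corner entry of the first column can be nonzero, in the second
    -- only that of the first row; either way the determinant is the corner entry times a smaller
    -- minor.
    by_cases hle : cols 0 ≤ rows 0
    · rw [Matrix.det_succ_column_zero, sum_eq_single 0]
      · simp only [Fin.val_zero, pow_zero, Matrix.of_apply, one_mul]
        exact N.mul_mem (hN _ _) ih'
      · intro i _ hi
        have := hrpos i hi
        simp [h (rows i) (cols 0) (by omega) (by omega)]
      · simp
    · rw [Matrix.det_succ_row_zero, sum_eq_single 0]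
      · simp only [Fin.val_zero, pow_zero, Matrix.of_apply, one_mul]
        exact N.mul_mem (hN _ _) ih'
      · intro j _ hj
        have := hcpos j hj
        simp [h (rows 0) (cols j) (by omega) (by omega)]
      · simp

/-- A matrix that vanishes on a block of rows `I` outside of fewer columns than `I` has rows is
singular. -/
theorem det_eq_zero_of_card_lt {n : Type*} [Fintype n] [DecidableEq n] {M : Matrix n n R}
    (I J : Finset n) (hc : #J < #I) (h : ∀ i ∈ I, ∀ j ∉ J, M i j = 0) : M.det = 0 := by
  rw [← Matrix.det_transpose, Matrix.det_apply]
  refine sum_eq_zero fun σ _ => ?_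
  have : ∃ i ∈ I, σ i ∉ J := by
    by_contra! hcon
    exact absurd (card_le_card_of_injOn σ hcon σ.injective.injOn) (not_le.2 hc)
  obtain ⟨i, hi, hj⟩ := this
  rw [prod_eq_zero (mem_univ i) (by simpa using h i hi _ hj), smul_zero]

/-- Adding a diagonal entry from `N` to a tridiagonal matrix with minors in `N`. -/
theorem MinorsMem.add_diag_single {M : ℕ → ℕ → R} (hM : MinorsMem N M)
    (ht : ∀ i j, i + 1 < j ∨ j + 1 < i → M i j = 0) {β : R} (hβ : β ∈ N) (k : ℕ) :
    MinorsMem N fun i j => M i j + if i = k ∧ j = k then β else 0 := by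
  intro r rows cols hr hc
  by_cases hk : (∃ p, rows p = k) ∧ ∃ q, cols q = k
  swap
  · convert hM r rows cols hr hc using 3
    ext i j
    have : ¬ (rows i = k ∧ cols j = k) := fun hh => hk ⟨⟨i, hh.1⟩, ⟨j, hh.2⟩⟩
    simp [this]
  obtain ⟨⟨p, hp⟩, q, hq⟩ := hk
  rcases r with _ | r
  · exact p.elim0
  set A : Matrix (Fin (r + 1)) (Fin (r + 1)) R := Matrix.of fun i j => M (rows i) (cols j) with hA
  -- The determinant is linear in row `p`, so the perturbation contributes `β` times the cofactor at
  -- `(p, q)`.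
  have hsplit : (Matrix.of fun i j => M (rows i) (cols j) +
      if rows i = k ∧ cols j = k then β else 0)
      = A.updateRow p (A p + β • Pi.single q 1) := by
    ext i j
    have hi : rows i = k ↔ i = p := by rw [← hp]; exact hr.injective.eq_iff
    have hj : cols j = k ↔ j = q := by rw [← hq]; exact hc.injective.eq_iff
    by_cases hip : i = p
    · subst hip
      by_cases hjq : j = q
      · subst hjq
        simp [hA, hp, hq]
      · simp [hA, hj, hjq]
    · simp [hA, hi, hip]
  rw [hsplit, Matrix.det_updateRow_add, Matrix.updateRow_eq_self, Matrix.det_updateRow_smul]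
  refine N.add_mem (hM _ _ _ hr hc) (N.mul_mem hβ ?_)
  rw [← Matrix.adjugate_apply, Matrix.adjugate_fin_succ_eq_det_submatrix]
  have hAz : ∀ i j, rows i + 1 < cols j ∨ cols j + 1 < rows i → A i j = 0 :=
    fun i j hij => ht _ _ hij
  -- For `p = q` the cofactor is a minor of `M` with sign `+1`. Otherwise indices above `k` on one
  -- side face indices below `k` on the other; tridiagonality makes that block zero, and it is too
  -- large for a nonsingular matrix.
  rcases lt_trichotomy p q with hpq | hpq | hpq
  · rw [det_eq_zero_of_card_lt (univ.filter fun i : Fin r => (p : ℕ) ≤ i)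
      (univ.filter fun i : Fin r => (q : ℕ) ≤ i), mul_zero]
    · exact N.zero_mem
    · have := q.is_lt
      refine card_lt_card ⟨fun i => ?_, fun hsub => ?_⟩
      · simp only [mem_filter, mem_univ, true_and]
        have : (p : ℕ) < q := hpq
        omega
      · have h2 : (p : ℕ) < q := hpq
        have := hsub (show (⟨p, by omega⟩ : Fin r) ∈ _ by simp)
        simp at this
        omega
    · intro i hi j hj
      simp only [mem_filter, mem_univ, true_and, not_le] at hi hj
      have h1 : p < p.succAbove i := by
        rw [Fin.succAbove_of_le_castSucc _ _ (by simpa [Fin.le_def] using hi)]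
        simp only [Fin.lt_def, Fin.val_succ]
        omega
      have h2 : q.succAbove j < q := by
        rw [Fin.succAbove_of_castSucc_lt _ _ (by simpa [Fin.lt_def] using hj)]
        simpa [Fin.lt_def] using hj
      have h3 := hr h1
      have h4 := hc h2
      exact hAz _ _ (by omega)
  · subst hpq
    rw [Even.neg_one_pow ⟨_, rfl⟩, one_mul]
    exact hM r _ _ (hr.comp (Fin.strictMono_succAbove p)) (hc.comp (Fin.strictMono_succAbove p))
  · rw [det_eq_zero_of_card_lt (univ.filter fun i : Fin r => (i : ℕ) < p)
      (univ.filter fun i : Fin r => (i : ℕ) < q), mul_zero]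
    · exact N.zero_mem
    · have := p.is_lt
      refine card_lt_card ⟨fun i => ?_, fun hsub => ?_⟩
      · simp only [mem_filter, mem_univ, true_and]
        have : (q : ℕ) < p := hpq
        omega
      · have h2 : (q : ℕ) < p := hpq
        have := hsub (show (⟨q, by omega⟩ : Fin r) ∈ _ by simpa using hpq)
        simp at this
    · intro i hi j hj
      simp only [mem_filter, mem_univ, true_and, not_lt] at hi hj
      have h1 : p.succAbove i < p := by
        rw [Fin.succAbove_of_castSucc_lt _ _ (by simpa [Fin.lt_def] using hi)]
        simpa [Fin.lt_def] using hi
      have h2 : q < q.succAbove j := by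
        rw [Fin.succAbove_of_le_castSucc _ _ (by simpa [Fin.le_def] using hj)]
        simp only [Fin.lt_def, Fin.val_succ]
        omega
      have h3 := hr h1
      have h4 := hc h2
      exact hAz _ _ (by omega)

/-- Adding a nonnegative multiple of the identity to a tridiagonal matrix with minors in `N`. -/
theorem MinorsMem.add_scalar {M : ℕ → ℕ → R} (hM : MinorsMem N M)
    (ht : ∀ i j, i + 1 < j ∨ j + 1 < i → M i j = 0) {β : R} (hβ : β ∈ N) :
    MinorsMem N fun i j => M i j + if i = j then β else 0 := by
  -- A given minor meets only finitely many diagonal positions, so they can be altered one at a time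
  -- below a cutoff `K`.
  have key : ∀ K : ℕ, MinorsMem N fun i j => M i j + if i = j ∧ j < K then β else 0 := by
    intro K
    induction K with
    | zero => simpa using hM
    | succ K ih =>
      convert ih.add_diag_single (fun i j hij => ?_) hβ K using 3 with i j
      · rw [add_assoc]
        congr 1
        by_cases h1 : i = j
        · subst h1
          rcases lt_trichotomy i K with h | h | h
          · simp [h, h.ne, Nat.lt_succ_of_lt h]
          · simp [h]
          · simp [h.ne', not_lt.2 h.le, Nat.not_lt.2 (Nat.succ_le_of_lt h)]
        · have : ¬ (i = K ∧ j = K) := fun hh => h1 (hh.1.trans hh.2.symm)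
          simp [h1, this]
      · have : i ≠ j := by omega
        simp [ht i j hij, this]
  intro r rows cols hr hc
  convert key (∑ j, cols j + 1) r rows cols hr hc using 3
  ext i j
  have : cols j < ∑ j, cols j + 1 := Nat.lt_succ_of_le
    (single_le_sum (f := cols) (fun _ _ => Nat.zero_le _) (mem_univ j))
  simp [this]

end Minors

/-! ### Row polynomials as iterates of a differential operator -/

section LahPolynomials

open Polynomial

variable {R : Type*} [CommRing R]

/-- The operator `1 + u D` on polynomials. -/
noncomputable def oneAddDeriv (u : R) : Module.End R R[X] := 1 + u • derivative

/-- Multiplication by the polynomial `p`. -/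
noncomputable def mulOp (p : R[X]) : Module.End R R[X] := LinearMap.mulLeft R p

theorem oneAddDeriv_apply (u : R) (p : R[X]) : oneAddDeriv u p = p + C u * derivative p := by
  simp [oneAddDeriv, smul_eq_C_mul]

theorem mulOp_apply (p q : R[X]) : mulOp p q = p * q := rfl

theorem coeff_oneAddDeriv (u : R) (p : R[X]) (k : ℕ) :
    (oneAddDeriv u p).coeff k = p.coeff k + u * (k + 1) * p.coeff (k + 1) := by
  rw [oneAddDeriv_apply, coeff_add, coeff_C_mul, coeff_derivative]
  ring

theorem coeff_C_mul_X_add_C_mul (c l : R) (p : R[X]) (k : ℕ) :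
    (C c * (X + C l) * p).coeff (k + 1) = c * p.coeff k + c * l * p.coeff (k + 1) := by
  rw [mul_assoc, coeff_C_mul, add_mul, coeff_add, coeff_X_mul, coeff_C_mul]
  ring

theorem coeff_zero_C_mul_X_add_C_mul (c l : R) (p : R[X]) :
    (C c * (X + C l) * p).coeff 0 = c * l * p.coeff 0 := by
  rw [mul_assoc, coeff_C_mul, add_mul, coeff_add, coeff_X_mul_zero, coeff_C_mul]
  ring

theorem oneAddDeriv_mul_mulOp (u c l : R) :
    oneAddDeriv u * mulOp (C c * (X + C l))
      = mulOp (C c * (X + C l)) * oneAddDeriv u + (u * c) • 1 := by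
  refine LinearMap.ext fun p => ?_
  simp only [Module.End.mul_apply, LinearMap.add_apply, LinearMap.smul_apply,
    Module.End.one_apply, oneAddDeriv_apply, mulOp_apply, derivative_mul, derivative_C,
    derivative_add, derivative_X, smul_eq_C_mul, C_mul]
  ring

/-- The row-generating polynomials of the generalized Lah triangle. -/
noncomputable def genLahPoly (a : ℕ) (b c d l : R) : ℕ → R[X]
  | 0 => 1
  | n + 1 => C (a * b * n + a * b * d) * genLahPoly a b c d l n
      + C c * (X + C l) * genLahPoly a b c d l n
      + C b * (X + C l) * derivative (genLahPoly a b c d l n)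

section Triangle

variable {a : ℕ} {b c d l : R} {T : ℕ → ℕ → R}

theorem IsGenLahTriangle.eq_coeff (hT : IsGenLahTriangle a b c d l T) (n k : ℕ) :
    T n k = (genLahPoly a b c d l n).coeff k := by
  induction n generalizing k with
  | zero =>
    rcases k with _ | k
    · simp [genLahPoly, hT.init]
    · rw [hT.lower 0 (k + 1) (Nat.succ_pos k), genLahPoly, coeff_one, if_neg (Nat.succ_ne_zero k)]
  | succ n ih =>
    rcases k with _ | k
    · rw [hT.rec_zero, ih, ih, genLahPoly, coeff_add, coeff_add, coeff_C_mul,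
        coeff_zero_C_mul_X_add_C_mul, coeff_zero_C_mul_X_add_C_mul, coeff_derivative]
      push_cast
      ring
    · rw [hT.rec_succ, ih, ih, ih, genLahPoly, coeff_add, coeff_add, coeff_C_mul,
        coeff_C_mul_X_add_C_mul, coeff_C_mul_X_add_C_mul, coeff_derivative, coeff_derivative]
      push_cast
      ring

theorem IsGenLahTriangle.rowPoly_eq (hT : IsGenLahTriangle a b c d l T) (n : ℕ) :
    rowPoly T n = genLahPoly a b c d l n := by
  ext k
  rw [← hT.eq_coeff, rowPoly, finsetSum_coeff]
  simp only [coeff_C_mul, coeff_X_pow, mul_ite, mul_one, mul_zero]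
  rw [sum_ite_eq, ite_eq_left_iff, mem_range]
  intro hk
  exact (hT.lower n k (by omega)).symm

theorem coeff_genLahPoly_eq_zero (n k : ℕ) (h : n < k) :
    (genLahPoly a b c d l n).coeff k = 0 := by
  induction n generalizing k with
  | zero => rw [genLahPoly, coeff_one, if_neg (by omega)]
  | succ n ih =>
    obtain ⟨k, rfl⟩ : ∃ k', k = k' + 1 := ⟨k - 1, by omega⟩
    rw [genLahPoly, coeff_add, coeff_add, coeff_C_mul, coeff_C_mul_X_add_C_mul,
      coeff_C_mul_X_add_C_mul, coeff_derivative, coeff_derivative, ih _ (by omega),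
      ih k (by omega), ih _ (by omega)]
    ring

theorem coeff_genLahPoly_self (n : ℕ) : (genLahPoly a b c d l n).coeff n = c ^ n := by
  induction n with
  | zero => simp [genLahPoly]
  | succ n ih =>
    rw [genLahPoly, coeff_add, coeff_add, coeff_C_mul, coeff_C_mul_X_add_C_mul,
      coeff_C_mul_X_add_C_mul, coeff_derivative, coeff_derivative, ih,
      coeff_genLahPoly_eq_zero n (n + 1) (by omega),
      coeff_genLahPoly_eq_zero n (n + 1 + 1) (by omega)]
    ring

theorem isGenLahTriangle_genLahPoly :
    IsGenLahTriangle a b c d l fun n k => (genLahPoly a b c d l n).coeff k where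
  init := by simp [genLahPoly]
  lower n k h := coeff_genLahPoly_eq_zero n k h
  rec_zero n := by
    rw [genLahPoly, coeff_add, coeff_add, coeff_C_mul, coeff_zero_C_mul_X_add_C_mul,
      coeff_zero_C_mul_X_add_C_mul, coeff_derivative]
    push_cast
    ring
  rec_succ n k := by
    rw [genLahPoly, coeff_add, coeff_add, coeff_C_mul, coeff_C_mul_X_add_C_mul,
      coeff_C_mul_X_add_C_mul, coeff_derivative, coeff_derivative]
    push_cast
    ring

/-- The recurrence involves `X` and `l` only through `X + l`, and differentiation commutes with
translation. -/
theorem genLahPoly_comp (a : ℕ) (b c d l q : R) (n : ℕ) :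
    (genLahPoly a b c d l n).comp (X + C q) = genLahPoly a b c d (l + q) n := by
  induction n with
  | zero => simp [genLahPoly]
  | succ n ih =>
    have hd := congrArg derivative ih
    rw [derivative_comp] at hd
    simp only [derivative_add, derivative_X, derivative_C, add_zero, one_mul] at hd
    simp only [genLahPoly, add_comp, mul_comp, C_comp, X_comp, ih, hd, C_add]
    ring

theorem eval_genLahPoly (a : ℕ) (b c d l q : R) (n : ℕ) :
    (genLahPoly a b c d l n).eval q = (genLahPoly a b c d (l + q) n).coeff 0 := by
  rw [← genLahPoly_comp, coeff_zero_eq_eval_zero, eval_comp]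
  simp

end Triangle

/-! ### The production operator and its minors -/

/-- The production operator of the generalized Lah triangle. -/
noncomputable def lahProd (a : ℕ) (u c β l : R) : Module.End R R[X] :=
  (β • 1 + mulOp (C c * (X + C l)) * oneAddDeriv u) * oneAddDeriv u ^ a

theorem oneAddDeriv_pow_mul_mulOp (a : ℕ) (u c l : R) :
    oneAddDeriv u ^ a * (mulOp (C c * (X + C l)) * oneAddDeriv u)
      = (mulOp (C c * (X + C l)) * oneAddDeriv u + (a * (u * c)) • 1) * oneAddDeriv u ^ a := by
  induction a with
  | zero => simp
  | succ a ih =>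
    rw [pow_succ', mul_assoc, ih, ← mul_assoc, mul_add, ← mul_assoc, oneAddDeriv_mul_mulOp]
    rw [← mul_assoc _ (oneAddDeriv u) (oneAddDeriv u ^ a)]
    congr 1
    simp only [add_mul, smul_mul_assoc, one_mul, mul_smul_comm, mul_one, Nat.cast_add,
      Nat.cast_one, add_smul]
    abel

theorem oneAddDeriv_pow_apply_one (a : ℕ) (u : R) : (oneAddDeriv u ^ a) (1 : R[X]) = 1 := by
  induction a with
  | zero => simp
  | succ a ih => rw [pow_succ', Module.End.mul_apply, ih, oneAddDeriv_apply]; simp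

/-- Write `S_n = abn + abd + YE`, so that `L_{n+1} = S_n L_n`, and let `P` be the production
operator. Moving `E^a` past `YE` adds `ab`, hence `P S_n = S_{n+1} P`. If `P L_n = L_{n+1}`, then `P
L_{n+1} = P S_n L_n = S_{n+1} L_{n+1}`, which is `L_{n+2}`. The induction starts because `E` fixes
constants. -/
theorem genLahPoly_succ_eq_lahProd (a : ℕ) {b c d l u : R} (hu : u * c = b) (n : ℕ) :
    genLahPoly a b c d l (n + 1) = lahProd a u c (a * b * d) l (genLahPoly a b c d l n) := by
  have hstep : ∀ n, genLahPoly a b c d l (n + 1)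
      = ((a * b * n : R) • 1 + ((a * b * d) • 1 + mulOp (C c * (X + C l)) * oneAddDeriv u) :
        Module.End R R[X]) (genLahPoly a b c d l n) := by
    intro n
    simp only [LinearMap.add_apply, LinearMap.smul_apply, Module.End.one_apply,
      Module.End.mul_apply, mulOp_apply, oneAddDeriv_apply, smul_eq_C_mul, genLahPoly, ← hu,
      C_mul, C_add]
    ring
  induction n with
  | zero =>
    rw [hstep, lahProd, Module.End.mul_apply]
    simp [genLahPoly, oneAddDeriv_pow_apply_one]
  | succ n ih =>
    have hcomm : lahProd a u c (a * b * d) l *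
        ((a * b * n : R) • 1 + ((a * b * d) • 1 + mulOp (C c * (X + C l)) * oneAddDeriv u))
      = ((a * b * (n + 1 : ℕ) : R) • 1 + ((a * b * d) • 1 +
        mulOp (C c * (X + C l)) * oneAddDeriv u)) * lahProd a u c (a * b * d) l := by
      have h := oneAddDeriv_pow_mul_mulOp a u c l
      rw [hu] at h
      set Z := mulOp (C c * (X + C l)) * oneAddDeriv u with hZ
      set F := oneAddDeriv u ^ a with hF
      rw [lahProd, ← hZ, ← hF, mul_assoc, mul_add F, mul_add F, h]
      simp only [add_mul, mul_add, smul_mul_assoc, one_mul, mul_smul_comm, mul_one, Nat.cast_add,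
        Nat.cast_one, mul_assoc]
      module
    rw [hstep (n + 1), ih, ← Module.End.mul_apply, ← hcomm, Module.End.mul_apply, ← hstep]
    rw [← ih]

/-- The matrix of an operator on polynomials in the monomial basis; rows are images. -/
noncomputable def opMat (A : Module.End R R[X]) (l k : ℕ) : R := (A (X ^ l)).coeff k

theorem map_eq_sum_coeff (φ : R[X] →ₗ[R] R) (p : R[X]) {K : ℕ} (h : p.natDegree < K) :
    φ p = ∑ j ∈ range K, p.coeff j * φ (X ^ j) := by
  conv_lhs => rw [p.as_sum_range' K h]
  rw [map_sum]
  refine sum_congr rfl fun j _ => ?_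
  rw [← C_mul_X_pow_eq_monomial, ← smul_eq_C_mul, map_smul, smul_eq_mul]

theorem coeff_apply_eq_sum (B : Module.End R R[X]) (p : R[X]) (k : ℕ) {K : ℕ}
    (h : p.natDegree < K) : (B p).coeff k = ∑ j ∈ range K, p.coeff j * opMat B j k :=
  map_eq_sum_coeff ((lcoeff R k).comp B) p h

variable {N : Subsemiring R}

theorem MinorsMem.opMat_mul {A B : Module.End R R[X]} (hA : MinorsMem N (opMat A))
    (hB : MinorsMem N (opMat B)) : MinorsMem N (opMat (B * A)) :=
  hA.mul hB fun l => ⟨(A (X ^ l)).natDegree + 1, fun _ hK k => coeff_apply_eq_sum B _ k hK⟩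

theorem minorsMem_opMat_C_mul_X_add_C {c l : R} (hc : c ∈ N) (hcl : c * l ∈ N) :
    MinorsMem N (opMat (mulOp (C c * (X + C l)))) := by
  have hco : ∀ i j, opMat (mulOp (C c * (X + C l))) i j =
      if j = i + 1 then c else if j = i then c * l else 0 := by
    intro i j
    rw [opMat, mulOp_apply, mul_assoc, coeff_C_mul, add_mul, coeff_add, ← pow_succ',
      coeff_X_pow, coeff_C_mul, coeff_X_pow]
    by_cases h1 : j = i + 1
    · simp [h1]
    · by_cases h2 : j = i <;> simp [h1, h2]
  refine MinorsMem.of_bidiagonal (fun i j => ?_) fun i j h1 h2 => ?_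
  · rw [hco]
    split_ifs
    exacts [hc, hcl, N.zero_mem]
  · rw [hco, if_neg h2, if_neg h1]

theorem opMat_oneAddDeriv (u : R) (i j : ℕ) :
    opMat (oneAddDeriv u) i j = if j = i then 1 else if i = j + 1 then u * (j + 1) else 0 := by
  rw [opMat, coeff_oneAddDeriv, coeff_X_pow, coeff_X_pow]
  by_cases h1 : j = i
  · simp [h1]
  · by_cases h2 : i = j + 1
    · simp [h2]
    · simp [h1, h2, Ne.symm h2]

theorem minorsMem_opMat_oneAddDeriv {u : R} (hu : u ∈ N) :
    MinorsMem N (opMat (oneAddDeriv u)) := by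
  refine MinorsMem.transpose (M := fun i j => opMat (oneAddDeriv u) j i)
    (MinorsMem.of_bidiagonal (fun i j => ?_) fun i j h1 h2 => ?_)
  · rw [opMat_oneAddDeriv]
    split_ifs
    · exact N.one_mem
    · exact N.mul_mem hu (by exact_mod_cast natCast_mem N (i + 1))
    · exact N.zero_mem
  · rw [opMat_oneAddDeriv, if_neg (Ne.symm h1), if_neg h2]

theorem opMat_one (i j : ℕ) : opMat (1 : Module.End R R[X]) i j = if i = j then 1 else 0 := by
  rw [opMat, Module.End.one_apply, coeff_X_pow]
  simp [eq_comm]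

theorem minorsMem_opMat_one : MinorsMem N (opMat (1 : Module.End R R[X])) := by
  refine MinorsMem.of_bidiagonal (fun i j => ?_) fun i j h1 _ => ?_
  · rw [opMat_one]
    split_ifs
    exacts [N.one_mem, N.zero_mem]
  · rw [opMat_one, if_neg (Ne.symm h1)]

theorem MinorsMem.opMat_pow {A : Module.End R R[X]} (hA : MinorsMem N (opMat A)) (n : ℕ) :
    MinorsMem N (opMat (A ^ n)) := by
  induction n with
  | zero => rw [pow_zero]; exact minorsMem_opMat_one
  | succ n ih => rw [pow_succ']; exact ih.opMat_mul hA

/-- With rows as images, `E` is lower bidiagonal and `Y` upper bidiagonal. Thus `YE` is tridiagonal,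
which is what adding the scalar `β` requires. -/
theorem minorsMem_opMat_lahProd (a : ℕ) {u c β l : R} (hu : u ∈ N) (hc : c ∈ N) (hβ : β ∈ N)
    (hl : l ∈ N) : MinorsMem N (opMat (lahProd a u c β l)) := by
  refine ((minorsMem_opMat_oneAddDeriv hu).opMat_pow a).opMat_mul ?_
  have hYE := (minorsMem_opMat_oneAddDeriv hu).opMat_mul
    (minorsMem_opMat_C_mul_X_add_C hc (N.mul_mem hc hl))
  convert hYE.add_scalar (fun i j hij => ?_) hβ using 3 with i j
  · rw [opMat, LinearMap.add_apply, coeff_add, add_comm, LinearMap.smul_apply, coeff_smul,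
      smul_eq_mul]
    congr 1
    exact (congrArg (β * ·) (opMat_one i j)).trans (by simp)
  · have hE := fun k => opMat_oneAddDeriv u i k
    simp only [opMat] at hE
    rw [opMat, Module.End.mul_apply, mulOp_apply]
    rcases j with _ | j
    · rw [coeff_zero_C_mul_X_add_C_mul, hE, if_neg (by omega), if_neg (by omega)]
      ring
    · rw [coeff_C_mul_X_add_C_mul, hE, hE, if_neg (by omega), if_neg (by omega),
        if_neg (by omega), if_neg (by omega)]
      ring

/-- Iterating an operator with minors in `N` on the polynomial `1` gives a triangle with minors
in `N`. -/
theorem minorsMem_coeff_iterate {P : Module.End R R[X]} (hP : MinorsMem N (opMat P)) {p : ℕ → R[X]}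
    (h0 : p 0 = 1) (hs : ∀ n, p (n + 1) = P (p n)) : MinorsMem N fun n k => (p n).coeff k := by
  refine hP.of_production (by simp [h0]) (fun k hk => ?_)
    fun n k => ⟨(p n).natDegree + 1, fun K hK => ?_⟩
  · rw [h0, coeff_one, if_neg hk.ne']
  · rw [hs]
    exact coeff_apply_eq_sum P _ k hK

/-- As `p (i + j) = P^j (p i)`, the Hankel matrix is the coefficient triangle times the matrix whose
column `j` is column 0 of the matrix of `P^j`. The transpose of this second factor is generated by
the transpose of `P`. -/
theorem minorsMem_hankel_iterate {P : Module.End R R[X]} (hP : MinorsMem N (opMat P)) {p : ℕ → R[X]}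
    (h0 : p 0 = 1) (hs : ∀ n, p (n + 1) = P (p n)) :
    MinorsMem N fun i j => (p (i + j)).coeff 0 := by
  have hpow : ∀ i j, p (i + j) = (P ^ j) (p i) := by
    intro i j
    induction j with
    | zero => simp
    | succ j ih => rw [← add_assoc, hs, ih, pow_succ', Module.End.mul_apply]
  have hV : MinorsMem N fun j k => opMat (P ^ j) k 0 := by
    refine hP.transpose.of_production (by simp [opMat]) (fun k hk => ?_)
      fun j k => ⟨(P (X ^ k)).natDegree + 1, fun K hK => ?_⟩
    · rw [pow_zero, opMat_one, if_neg hk.ne']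
    · rw [opMat, pow_succ, Module.End.mul_apply, coeff_apply_eq_sum _ _ 0 hK]
      exact sum_congr rfl fun _ _ => mul_comm _ _
  refine (minorsMem_coeff_iterate hP h0 hs).mul hV.transpose
    fun i => ⟨(p i).natDegree + 1, fun K hK j => ?_⟩
  rw [hpow, coeff_apply_eq_sum _ _ 0 hK]

/-- The element `u` stands for `b / c` without division: `u = 1` serves `c = b`, and `u = c⁻¹ b`
serves an invertible constant `c`. -/
theorem minorsMem_coeff_genLahPoly (a : ℕ) {b c d l u : R} (hb : u * c = b) (hu : u ∈ N)
    (hc : c ∈ N) (hd : d ∈ N) (hl : l ∈ N) :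
    MinorsMem N fun n k => (genLahPoly a b c d l n).coeff k :=
  minorsMem_coeff_iterate (minorsMem_opMat_lahProd a hu hc
    (N.mul_mem (N.mul_mem (natCast_mem N a) (hb ▸ N.mul_mem hu hc)) hd) hl) rfl
    (genLahPoly_succ_eq_lahProd a hb)

theorem minorsMem_hankel_genLahPoly (a : ℕ) {b c d l u : R} (hb : u * c = b) (hu : u ∈ N)
    (hc : c ∈ N) (hd : d ∈ N) (hl : l ∈ N) :
    MinorsMem N fun i j => (genLahPoly a b c d l (i + j)).coeff 0 :=
  minorsMem_hankel_iterate (minorsMem_opMat_lahProd a hu hc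
    (N.mul_mem (N.mul_mem (natCast_mem N a) (hb ▸ N.mul_mem hu hc)) hd) hl) rfl
    (genLahPoly_succ_eq_lahProd a hb)

end LahPolynomials

/-! ### Log-convexity of order 3 from Hankel minors -/

section LogConvex

variable {R : Type*} [CommRing R] {N : Subsemiring R}

/-- Let `H_r(i)` be the Hankel minor of order `r` starting at `α_i`. The Desnanot–Jacobi identity
`H_r(i) H_r(i+2) - H_r(i+1)^2 = H_{r+1}(i) H_{r-1}(i+2)` gives `ℒ²[α]_i = α_{i+2} H_3(i)` and
`ℒ³[α]_i = α_{i+2} α_{i+4} H_4(i) H_2(i+2) + H_2(i+2) H_3(i+1)^2`. -/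
theorem logConvexOp_iterate_mem {α : ℕ → R} (h : MinorsMem N fun i j => α (i + j)) {m : ℕ}
    (hm : m ≤ 3) (i : ℕ) : logConvexOp^[m] α i ∈ N := by
  have hα : ∀ i, α i ∈ N := fun i => by simpa using h.apply i 0
  have hmin : ∀ r i, (Matrix.of fun s t : Fin r => α (i + s + t)).det ∈ N := fun r i =>
    h r (fun s => i + s) (fun t => t) (fun _ _ hst => Nat.add_lt_add_left hst i)
      fun _ _ hst => hst
  have h2 : ∀ i, α i * α (i + 2) - α (i + 1) ^ 2 ∈ N := fun i => by
    have := hmin 2 i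
    rw [Matrix.det_fin_two] at this
    convert this using 1
    simp only [Matrix.of_apply, Fin.val_zero, Fin.val_one, add_zero, add_assoc, Nat.reduceAdd]
    ring
  have h3 := hmin 3
  have h4 := hmin 4
  simp only [Matrix.det_succ_row_zero, Fin.sum_univ_succ, Matrix.of_apply] at h3 h4
  simp [Fin.succAbove, Fin.lt_def, add_assoc] at h3 h4
  interval_cases m
  · exact hα i
  · exact h2 i
  · have e := N.mul_mem (hα (i + 2)) (h3 i)
    convert e using 1
    simp only [Function.iterate_succ, Function.iterate_zero, Function.comp_apply, id, logConvexOp,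
      add_assoc, Nat.reduceAdd]
    ring
  · have e := N.add_mem (N.mul_mem (N.mul_mem (hα (i + 2)) (hα (i + 4)))
      (N.mul_mem (h4 i) (h2 (i + 2)))) (N.mul_mem (h2 (i + 2)) (N.mul_mem (h3 (i + 1)) (h3 (i + 1))))
    convert e using 1
    simp only [Function.iterate_succ, Function.iterate_zero, Function.comp_apply, id, logConvexOp,
      add_assoc, Nat.reduceAdd]
    ring

end LogConvex

/-! ### Coefficientwise total positivity -/

section Instances

variable {σ : Type*}

/-- The subsemiring of polynomials with nonnegative coefficients. -/
def nonnegCoeffs (σ : Type*) : Subsemiring (MvPolynomial σ ℝ) where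
  carrier := {p | NonnegCoeffs p}
  zero_mem' := fun _ => by simp
  one_mem' := fun e => by
    classical
    rw [MvPolynomial.coeff_one]
    split_ifs <;> norm_num
  add_mem' := fun hp hq e => by
    rw [MvPolynomial.coeff_add]
    exact add_nonneg (hp e) (hq e)
  mul_mem' := fun hp hq e => by
    classical
    rw [MvPolynomial.coeff_mul]
    exact sum_nonneg fun x _ => mul_nonneg (hp _) (hq _)

theorem X_mem_nonnegCoeffs (s : σ) : (MvPolynomial.X s : MvPolynomial σ ℝ) ∈ nonnegCoeffs σ := by
  classical
  intro e
  rw [MvPolynomial.coeff_X]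
  split_ifs <;> norm_num

theorem C_mem_nonnegCoeffs {r : ℝ} (hr : 0 ≤ r) : MvPolynomial.C r ∈ nonnegCoeffs σ := by
  classical
  intro e
  rw [MvPolynomial.coeff_C]
  split_ifs
  exacts [hr, le_rfl]

theorem IsGenLahTriangle.isXTP_of_C {a d : ℕ} {c : ℝ} (hc : 0 < c) {b l : MvPolynomial σ ℝ}
    (hb : b ∈ nonnegCoeffs σ) (hl : l ∈ nonnegCoeffs σ) {T : ℕ → ℕ → MvPolynomial σ ℝ}
    (hT : IsGenLahTriangle a b (MvPolynomial.C c) d l T) : IsXTP T := by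
  have hu : MvPolynomial.C c⁻¹ * b * MvPolynomial.C c = b := by
    rw [mul_right_comm, ← MvPolynomial.C_mul, inv_mul_cancel₀ hc.ne', MvPolynomial.C_1, one_mul]
  have h := minorsMem_coeff_genLahPoly a (d := (d : MvPolynomial σ ℝ)) hu
    ((nonnegCoeffs σ).mul_mem (C_mem_nonnegCoeffs (inv_nonneg.2 hc.le)) hb)
    (C_mem_nonnegCoeffs hc.le) (natCast_mem _ d) hl
  simp only [← hT.eq_coeff] at h
  exact h

theorem IsGenLahTriangle.isXTP {a : ℕ} {b d l : MvPolynomial σ ℝ}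
    (hb : b ∈ nonnegCoeffs σ) (hd : d ∈ nonnegCoeffs σ) (hl : l ∈ nonnegCoeffs σ)
    {T : ℕ → ℕ → MvPolynomial σ ℝ} (hT : IsGenLahTriangle a b b d l T) : IsXTP T := by
  have h := minorsMem_coeff_genLahPoly a (one_mul b) (nonnegCoeffs σ).one_mem hb hd hl
  simp only [← hT.eq_coeff] at h
  exact h

theorem isXSM_coeff_zero_genLahPoly (a : ℕ) {b d l : MvPolynomial σ ℝ}
    (hb : b ∈ nonnegCoeffs σ) (hd : d ∈ nonnegCoeffs σ) (hl : l ∈ nonnegCoeffs σ) :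
    IsXSM (fun n => (genLahPoly a b b d l n).coeff 0) ∧
      IsXLogConvexOfOrder 3 (fun n => (genLahPoly a b b d l n).coeff 0) := by
  have h := minorsMem_hankel_genLahPoly a (one_mul b) (nonnegCoeffs σ).one_mem hb hd hl
  exact ⟨h, fun m hm i => logConvexOp_iterate_mem (N := nonnegCoeffs σ)
    (α := fun n => (genLahPoly a b b d l n).coeff 0) h hm i⟩

end Instances

/-! ### Falling factorials and the explicit formula -/

section ExplicitFormula

open Polynomial

/-- The linear functional `X ^ j ↦ x (x - 1) ⋯ (x - j + 1)`. -/
noncomputable def descFunctional (x : ℕ) : ℝ[X] →ₗ[ℝ] ℝ :=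
  Polynomial.lsum fun j => (x.descFactorial j : ℝ) • LinearMap.id

theorem descFunctional_monomial (x j : ℕ) (r : ℝ) :
    descFunctional x (monomial j r) = x.descFactorial j * r := by
  rw [descFunctional, Polynomial.lsum_apply, sum_monomial_index _ _ (by simp)]
  simp

theorem cast_descFactorial_succ (x j : ℕ) :
    (x.descFactorial (j + 1) : ℝ) = (x - j) * x.descFactorial j := by
  rw [Nat.descFactorial_succ, Nat.cast_mul]
  rcases le_or_gt j x with h | h
  · rw [Nat.cast_sub h]
  · simp [Nat.descFactorial_eq_zero_iff_lt.2 h]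

/-- On `X^j` this is `(x)_{j+1} + j (x)_j = x (x)_j`. The operator `X + XD` of the recurrence at `l
= 0` thus becomes multiplication by `x`. -/
theorem descFunctional_X_mul_add (x : ℕ) (p : ℝ[X]) :
    descFunctional x (X * p + X * derivative p) = x * descFunctional x p := by
  induction p using Polynomial.induction_on' with
  | add p q hp hq =>
    rw [derivative_add, map_add (descFunctional x) p, mul_add (x : ℝ), ← hp, ← hq,
      ← map_add (descFunctional x)]
    congr 1
    ring
  | monomial j r =>
    have h1 : X * monomial j r + X * derivative (monomial j r)
        = monomial (j + 1) r + monomial j (j * r) := by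
      rw [X_mul_monomial, derivative_monomial]
      rcases j with _ | j
      · simp
      · rw [X_mul_monomial, Nat.add_sub_cancel, mul_comm r]
    rw [h1, map_add, descFunctional_monomial, descFunctional_monomial, descFunctional_monomial,
      cast_descFactorial_succ]
    ring

theorem descFunctional_genLahPoly (a : ℕ) (b d : ℝ) (n x : ℕ) :
    descFunctional x (genLahPoly a b b d 0 n) = ∏ r ∈ range n, (b * x + a * b * r + a * b * d) := by
  induction n with
  | zero =>
    rw [genLahPoly, ← monomial_zero_one, descFunctional_monomial]
    simp
  | succ n ih =>
    have h1 : genLahPoly a b b d 0 (n + 1) = (a * b * n + a * b * d) • genLahPoly a b b d 0 n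
        + b • (X * genLahPoly a b b d 0 n + X * derivative (genLahPoly a b b d 0 n)) := by
      rw [genLahPoly, smul_eq_C_mul, smul_eq_C_mul, C_0]
      ring
    rw [h1, map_add, map_smul, map_smul, descFunctional_X_mul_add, ih, prod_range_succ,
      smul_eq_mul, smul_eq_mul]
    ring

theorem sum_coeff_mul_descFactorial (a : ℕ) (b d : ℝ) (n x : ℕ) {K : ℕ} (hK : n < K) :
    ∑ j ∈ range K, (genLahPoly a b b d 0 n).coeff j * x.descFactorial j
      = ∏ r ∈ range n, (b * x + a * b * r + a * b * d) := by
  rw [← descFunctional_genLahPoly, map_eq_sum_coeff (descFunctional x) _ (K := K)]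
  · simp only [X_pow_eq_monomial, descFunctional_monomial, mul_one]
  · exact lt_of_le_of_lt (natDegree_le_iff_coeff_eq_zero.2 fun k hk =>
      coeff_genLahPoly_eq_zero n k hk) hK

/-- At `l = 0` a step of the recurrence either raises the column, with weight `c`, or keeps it, with
a weight divisible by `b`. -/
theorem coeff_genLahPoly_scale (a : ℕ) (b c d : ℝ) (n j : ℕ) (hj : j ≤ n) :
    (genLahPoly a b c d 0 n).coeff j
      = b ^ (n - j) * c ^ j * (genLahPoly a 1 1 d 0 n).coeff j := by
  induction n generalizing j with
  | zero => obtain rfl : j = 0 := by omega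
            simp [genLahPoly]
  | succ n ih =>
    have hl := (isGenLahTriangle_genLahPoly (a := a) (b := b) (c := c) (d := d) (l := 0))
    have hr := (isGenLahTriangle_genLahPoly (a := a) (b := (1 : ℝ)) (c := 1) (d := d) (l := 0))
    rcases j with _ | j
    · rw [hl.rec_zero, hr.rec_zero, ih 0 (Nat.zero_le _), Nat.sub_zero, Nat.sub_zero]
      ring
    · rw [hl.rec_succ, hr.rec_succ, ih j (by omega), Nat.add_sub_add_right]
      rcases Nat.lt_or_ge j n with h | h
      · rw [ih (j + 1) h, (by omega : n - j = n - (j + 1) + 1)]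
        ring
      · rw [coeff_genLahPoly_eq_zero n (j + 1) (by omega),
          coeff_genLahPoly_eq_zero n (j + 1) (by omega)]
        ring

/-- Taylor expansion of the polynomial for `l = 0` at the point `l`. -/
theorem coeff_genLahPoly_eq_sum (a : ℕ) (b c d l : ℝ) (n k : ℕ) :
    (genLahPoly a b c d l n).coeff k = ∑ j ∈ range (n + 1),
      (k + j).choose k * l ^ j * (genLahPoly a b c d 0 n).coeff (k + j) := by
  have h := genLahPoly_comp a b c d 0 l n
  rw [zero_add] at h
  rw [← h, ← taylor_apply, taylor_coeff, eval_eq_sum_range' (n := n + 1)]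
  · refine sum_congr rfl fun j _ => ?_
    rw [hasseDeriv_coeff, add_comm j k]
    ring
  · refine Nat.lt_succ_of_le (natDegree_le_iff_coeff_eq_zero.2 fun j hj => ?_)
    rw [hasseDeriv_coeff, coeff_genLahPoly_eq_zero n _ (by omega), mul_zero]

theorem sum_neg_one_pow_choose_mul_choose (m n : ℕ) :
    ∑ i ∈ range (n + 1), (-1 : ℝ) ^ (n - i) * n.choose i * i.choose m = if n = m then 1 else 0 := by
  have h := fwdDiff_iter_choose_zero m n
  rw [fwdDiff_iter_eq_sum_shift] at h
  have h' := congrArg (Int.cast : ℤ → ℝ) h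
  push_cast [smul_eq_mul] at h'
  simpa using h'

/-- The product has a Newton expansion in the `i.choose j` with coefficients `j! T_{n,j}`; the
`k`-th difference at 0 extracts the `k`-th one. -/
theorem sum_neg_one_pow_choose_mul_prod (a : ℕ) (d : ℝ) (n k : ℕ) :
    ∑ i ∈ range (k + 1), (-1 : ℝ) ^ (k - i) * k.choose i * ∏ r ∈ range n, (i + a * r + a * d : ℝ)
      = k.factorial * (genLahPoly a 1 1 d 0 n).coeff k := by
  have h : ∀ i : ℕ, ∏ r ∈ range n, (i + a * r + a * d : ℝ) = ∑ j ∈ range (n + k + 1),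
      (genLahPoly a 1 1 d 0 n).coeff j * (j.factorial * i.choose j) := by
    intro i
    have := sum_coeff_mul_descFactorial a 1 d n i (K := n + k + 1) (by omega)
    simp only [one_mul, mul_one] at this
    rw [← this]
    refine sum_congr rfl fun j _ => ?_
    rw [Nat.descFactorial_eq_factorial_mul_choose, Nat.cast_mul]
  simp only [h, mul_sum]
  rw [sum_comm]
  have h2 : ∀ j ∈ range (n + k + 1), ∑ i ∈ range (k + 1), (-1 : ℝ) ^ (k - i) * k.choose i *
      ((genLahPoly a 1 1 d 0 n).coeff j * (j.factorial * i.choose j))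
      = if k = j then j.factorial * (genLahPoly a 1 1 d 0 n).coeff j else 0 := by
    intro j _
    rw [← mul_one (_ * Polynomial.coeff _ _), ← mul_ite_zero, ← sum_neg_one_pow_choose_mul_choose, mul_sum]
    exact sum_congr rfl fun i _ => by ring
  rw [sum_congr rfl h2, sum_ite_eq, if_pos (mem_range.2 (by omega))]

/-- Only the products `e * D i` matter, so `e` and `D` cover both readings of the falling factorial,
`a ≥ 1` and `a = 0`. For `k + j > n` the integer power of `b` has negative exponent, but its
cofactor is a coefficient beyond the degree; no assumption `b ≠ 0` is needed. -/
theorem hasSum_genLahPoly_coeff (a : ℕ) (b c d l : ℝ) (n k : ℕ) (e : ℝ) (D : ℕ → ℝ)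
    (hD : ∀ i : ℕ, e * D i = (-1) ^ n * ∏ r ∈ range n, (i + a * r + a * d : ℝ)) :
    HasSum (fun j : ℕ => e / (k.factorial : ℝ) * ∑ i ∈ range (k + j + 1),
        (-1 : ℝ) ^ ((n : ℤ) + k + j - i) * b ^ ((n : ℤ) - k - j) * c ^ (k + j) * l ^ j /
          (j.factorial : ℝ) * ((k + j).choose i : ℝ) * D i)
      ((genLahPoly a b c d l n).coeff k) := by
  have hterm : ∀ j : ℕ, e / (k.factorial : ℝ) * ∑ i ∈ range (k + j + 1),
        (-1 : ℝ) ^ ((n : ℤ) + k + j - i) * b ^ ((n : ℤ) - k - j) * c ^ (k + j) * l ^ j /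
          (j.factorial : ℝ) * ((k + j).choose i : ℝ) * D i
      = b ^ ((n : ℤ) - k - j) * c ^ (k + j) * l ^ j * (k + j).choose k *
        (genLahPoly a 1 1 d 0 n).coeff (k + j) := by
    intro j
    have hfac : ((k + j).factorial : ℝ) = (k + j).choose k * k.factorial * j.factorial := by
      rw [← Nat.add_choose_mul_factorial_mul_factorial k j, ← Nat.choose_symm_add]
      push_cast
      rfl
    have h2 : ∑ i ∈ range (k + j + 1),
        (-1 : ℝ) ^ ((n : ℤ) + k + j - i) * b ^ ((n : ℤ) - k - j) * c ^ (k + j) * l ^ j /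
          (j.factorial : ℝ) * ((k + j).choose i : ℝ) * (e * D i)
        = b ^ ((n : ℤ) - k - j) * c ^ (k + j) * l ^ j / (j.factorial : ℝ) *
          ((k + j).factorial * (genLahPoly a 1 1 d 0 n).coeff (k + j)) := by
      rw [← sum_neg_one_pow_choose_mul_prod, mul_sum]
      refine sum_congr rfl fun i hi => ?_
      have hi' : i ≤ k + j := Nat.lt_succ_iff.1 (mem_range.1 hi)
      have hsign : (-1 : ℝ) ^ ((n : ℤ) + k + j - i) = (-1) ^ n * (-1) ^ (k + j - i) := by
        rw [← pow_add, ← zpow_natCast]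
        congr 1
        push_cast [Nat.cast_sub hi']
        ring
      have hsq : ((-1 : ℝ) ^ n) * (-1) ^ n = 1 := by rw [← mul_pow]; simp
      rw [hD, hsign]
      linear_combination (b ^ ((n : ℤ) - k - j) * c ^ (k + j) * l ^ j / (j.factorial : ℝ) *
        (-1) ^ (k + j - i) * (k + j).choose i * ∏ r ∈ range n, (i + a * r + a * d : ℝ)) * hsq
    rw [hfac] at h2
    have hk0 : (k.factorial : ℝ) ≠ 0 := by exact_mod_cast k.factorial_ne_zero
    have hj0 : (j.factorial : ℝ) ≠ 0 := by exact_mod_cast j.factorial_ne_zero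
    rw [div_mul_eq_mul_div, div_eq_iff hk0, mul_sum]
    rw [sum_congr rfl fun (i : ℕ) _ => (by ring : e * ((-1 : ℝ) ^ ((n : ℤ) + k + j - i) *
      b ^ ((n : ℤ) - k - j) * c ^ (k + j) * l ^ j / (j.factorial : ℝ) * ((k + j).choose i : ℝ) *
      D i) = (-1 : ℝ) ^ ((n : ℤ) + k + j - i) *
      b ^ ((n : ℤ) - k - j) * c ^ (k + j) * l ^ j / (j.factorial : ℝ) * ((k + j).choose i : ℝ) *
      (e * D i)), h2]
    field_simp
  simp only [hterm]
  rw [coeff_genLahPoly_eq_sum]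
  have hzero : ∀ j, n < k + j → (genLahPoly a 1 1 d 0 n).coeff (k + j) = 0 :=
    fun j hj => coeff_genLahPoly_eq_zero n _ hj
  have hsum : ∑ j ∈ range (n + 1), ((k + j).choose k : ℝ) * l ^ j *
      (genLahPoly a b c d 0 n).coeff (k + j)
      = ∑ j ∈ range (n + 1), b ^ ((n : ℤ) - k - j) * c ^ (k + j) * l ^ j * (k + j).choose k *
        (genLahPoly a 1 1 d 0 n).coeff (k + j) := by
    refine sum_congr rfl fun j _ => ?_
    rcases Nat.lt_or_ge n (k + j) with h | h
    · rw [hzero j h, coeff_genLahPoly_eq_zero n _ h]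
      ring
    · rw [coeff_genLahPoly_scale a b c d n (k + j) h, (by push_cast [Nat.cast_sub h]; ring :
        (n : ℤ) - k - j = ((n - (k + j) : ℕ) : ℤ)), zpow_natCast]
      ring
  rw [hsum]
  refine hasSum_sum_of_ne_finset_zero fun j hj => ?_
  rw [hzero j (by rw [mem_range] at hj; omega), mul_zero]

theorem pow_mul_eval_descPochhammer {a : ℕ} (ha : 1 ≤ a) (d : ℝ) (n i : ℕ) :
    (a : ℝ) ^ n * (descPochhammer ℝ n).eval (-((i + a * d) / a))
      = (-1) ^ n * ∏ r ∈ range n, (i + a * r + a * d : ℝ) := by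
  have ha' : (a : ℝ) ≠ 0 := by exact_mod_cast (by omega : a ≠ 0)
  have hc : ∀ x : ℝ, x ^ n = ∏ r ∈ range n, x := fun x => by simp
  rw [descPochhammer_eval_eq_prod_range, hc, hc (-1), ← prod_mul_distrib, ← prod_mul_distrib]
  refine prod_congr rfl fun r _ => ?_
  field_simp
  ring

end ExplicitFormula

/-! ### Stieltjes moments: gamma laws and Poisson mixtures -/

section StieltjesMoments

open MeasureTheory
open scoped NNReal ENNReal

/-- Lower integrals on `ℝ≥0` allow sums and products of measures to be handled by Tonelli;
integrability follows at the end from finiteness of the moments. -/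
theorem isStieltjesMoment_of_lintegral {α : ℕ → ℝ} (hα : ∀ n, 0 ≤ α n) (μ : Measure ℝ≥0)
    (h : ∀ n : ℕ, ∫⁻ x, (x : ℝ≥0∞) ^ n ∂μ = ENNReal.ofReal (α n)) : IsStieltjesMoment α := by
  have hc : Measurable ((↑) : ℝ≥0 → ℝ) := measurable_coe_nnreal_real
  have hint : ∀ n : ℕ, ∫⁻ x : ℝ, ENNReal.ofReal (x ^ n) ∂(μ.map ((↑) : ℝ≥0 → ℝ))
      = ENNReal.ofReal (α n) := by
    intro n
    rw [lintegral_map (by fun_prop) hc, ← h]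
    refine lintegral_congr fun x => ?_
    rw [ENNReal.ofReal_pow x.coe_nonneg, ENNReal.ofReal_coe_nnreal]
  have hae : ∀ᵐ x : ℝ ∂(μ.map ((↑) : ℝ≥0 → ℝ)), 0 ≤ x := by
    rw [ae_map_iff hc.aemeasurable measurableSet_Ici]
    exact Filter.Eventually.of_forall fun x => x.2
  have hae' : ∀ n : ℕ, 0 ≤ᵐ[μ.map ((↑) : ℝ≥0 → ℝ)] fun x : ℝ => x ^ n := fun n =>
    hae.mono fun x hx => pow_nonneg hx n
  refine ⟨μ.map (↑), ?_, fun n => ⟨⟨by fun_prop, ?_⟩, ?_⟩⟩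
  · rw [Measure.map_apply hc measurableSet_Iio]
    convert measure_empty (μ := μ)
    ext x
    simp
  · rw [hasFiniteIntegral_iff_ofReal (hae' n), hint]
    exact ENNReal.ofReal_lt_top
  · rw [integral_eq_lintegral_of_nonneg_ae (hae' n) (by fun_prop), hint,
      ENNReal.toReal_ofReal (hα n)]

theorem IsStieltjesMoment.nonneg {α : ℕ → ℝ} (h : IsStieltjesMoment α) (n : ℕ) : 0 ≤ α n := by
  obtain ⟨μ, h0, hm⟩ := h
  rw [(hm n).2]
  refine integral_nonneg_of_ae ?_
  have : ∀ᵐ x : ℝ ∂μ, ¬ x < 0 := measure_eq_zero_iff_ae_notMem.1 h0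
  exact this.mono fun x hx => pow_nonneg (not_lt.1 hx) n

theorem IsStieltjesMoment.exists_lintegral {α : ℕ → ℝ} (h : IsStieltjesMoment α) :
    ∃ μ : Measure ℝ≥0, ∀ n : ℕ, ∫⁻ x, (x : ℝ≥0∞) ^ n ∂μ = ENNReal.ofReal (α n) := by
  obtain ⟨μ, h0, hm⟩ := h
  have hae : ∀ᵐ x : ℝ ∂μ, 0 ≤ x := by
    have : ∀ᵐ x : ℝ ∂μ, ¬ x < 0 := measure_eq_zero_iff_ae_notMem.1 h0
    exact this.mono fun x hx => not_lt.1 hx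
  refine ⟨μ.map Real.toNNReal, fun n => ?_⟩
  rw [lintegral_map (by fun_prop) measurable_real_toNNReal, (hm n).2,
    ofReal_integral_eq_lintegral_ofReal (hm n).1 (hae.mono fun x hx => pow_nonneg hx n)]
  refine lintegral_congr_ae (hae.mono fun x hx => ?_)
  exact (ENNReal.ofReal_pow hx n).symm

theorem lintegral_gamma {s : ℝ} (hs : 0 < s) :
    ∫⁻ x in Set.Ioi (0 : ℝ), ENNReal.ofReal (Real.exp (-x) * x ^ (s - 1))
      = ENNReal.ofReal (Real.Gamma s) := by
  rw [Real.Gamma_eq_integral hs, ofReal_integral_eq_lintegral_ofReal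
    (Real.GammaIntegral_convergent hs)]
  filter_upwards [ae_restrict_mem measurableSet_Ioi] with x hx
  exact mul_nonneg (Real.exp_pos _).le (Real.rpow_nonneg (le_of_lt hx) _)

theorem Gamma_add_nat_eq_prod {s : ℝ} (hs : 0 < s) (n : ℕ) :
    Real.Gamma (s + n) = Real.Gamma s * ∏ i ∈ range n, (s + i) := by
  induction n with
  | zero => simp
  | succ n ih =>
    rw [Nat.cast_succ, ← add_assoc, Real.Gamma_add_one (by positivity), ih, prod_range_succ]
    ring

/-- The rising products `h (h + a) ⋯ (h + (n - 1) a)` are the moments of a measure. -/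
theorem exists_lintegral_eq_prod {h a : ℝ} (hh : 0 ≤ h) (ha : 0 ≤ a) :
    ∃ γ : Measure ℝ≥0, SFinite γ ∧
      ∀ n : ℕ, ∫⁻ x, (x : ℝ≥0∞) ^ n ∂γ = ENNReal.ofReal (∏ i ∈ range n, (h + a * i)) := by
  rcases ha.eq_or_lt with rfl | ha'
  · refine ⟨Measure.dirac h.toNNReal, inferInstance, fun n => ?_⟩
    rw [lintegral_dirac]
    simp only [zero_mul, add_zero, prod_const, card_range]
    rw [ENNReal.ofReal_pow hh, ENNReal.ofReal]
  rcases hh.eq_or_lt with rfl | hh'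
  · refine ⟨Measure.dirac 0, inferInstance, fun n => ?_⟩
    rw [lintegral_dirac]
    rcases n with _ | n
    · simp
    · rw [prod_range_succ']
      simp
  have hs : 0 < h / a := div_pos hh' ha'
  have hG : 0 < Real.Gamma (h / a) := Real.Gamma_pos_of_pos hs
  -- The gamma density of shape `h / a`; the pushforward by `x ↦ a x` then has the required moments
  -- by the functional equation of `Γ`. The cases `a = 0` and `h = 0` were point masses.
  let w : ℝ → ℝ≥0∞ := fun x =>
    ENNReal.ofReal ((Real.Gamma (h / a))⁻¹) * ENNReal.ofReal (Real.exp (-x) * x ^ (h / a - 1))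
  have hw : Measurable w := by fun_prop
  refine ⟨(((volume.restrict (Set.Ioi (0 : ℝ))).withDensity w).map fun x => (a * x).toNNReal),
    inferInstance, fun n => ?_⟩
  rw [lintegral_map (by fun_prop) (by fun_prop), lintegral_withDensity_eq_lintegral_mul _ hw
    (by fun_prop)]
  have h1 : ∫⁻ x in Set.Ioi (0 : ℝ), (w * fun x => (((a * x).toNNReal : ℝ≥0) : ℝ≥0∞) ^ n) x
      = ∫⁻ x in Set.Ioi (0 : ℝ), ENNReal.ofReal ((Real.Gamma (h / a))⁻¹ * a ^ n) *
        ENNReal.ofReal (Real.exp (-x) * x ^ (h / a + n - 1)) := by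
    refine setLIntegral_congr_fun measurableSet_Ioi fun x hx => ?_
    have hx' : (0 : ℝ) < x := hx
    have hax : 0 ≤ a * x := by positivity
    change ENNReal.ofReal _ * ENNReal.ofReal _ * ENNReal.ofReal (a * x) ^ n = _
    rw [← ENNReal.ofReal_pow hax, ← ENNReal.ofReal_mul (by positivity),
      ← ENNReal.ofReal_mul (by positivity), ← ENNReal.ofReal_mul (by positivity)]
    congr 1
    rw [show h / a + n - 1 = (h / a - 1) + n by ring, Real.rpow_add hx', Real.rpow_natCast]
    ring
  rw [h1, lintegral_const_mul _ (by fun_prop), lintegral_gamma (by positivity),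
    ← ENNReal.ofReal_mul (by positivity), Gamma_add_nat_eq_prod hs]
  congr 1
  have h2 : ∏ i ∈ range n, (h + a * i) = a ^ n * ∏ i ∈ range n, (h / a + i) := by
    rw [← card_range n, ← prod_const, card_range, ← prod_mul_distrib]
    refine prod_congr rfl fun i _ => ?_
    field_simp
  rw [h2]
  field_simp

theorem isStieltjesMoment_prod {h a : ℝ} (hh : 0 ≤ h) (ha : 0 ≤ a) :
    IsStieltjesMoment fun n => ∏ i ∈ range n, (h + a * i) := by
  obtain ⟨γ, -, hγ⟩ := exists_lintegral_eq_prod hh ha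
  exact isStieltjesMoment_of_lintegral (fun n => prod_nonneg fun i _ => by positivity) γ hγ

theorem smeval_descPochhammer_eq_prod (r : ℝ) (n : ℕ) :
    (descPochhammer ℤ n).smeval r = ∏ i ∈ range n, (r - i) := by
  induction n with
  | zero => simp
  | succ n ih =>
    rw [descPochhammer_succ_right, Polynomial.smeval_mul, ih, prod_range_succ,
      Polynomial.smeval_sub, Polynomial.smeval_X, Polynomial.smeval_natCast]
    simp

theorem factorial_mul_choose_eq_prod (r : ℝ) (n : ℕ) :
    (n.factorial : ℝ) * Ring.choose r n = ∏ i ∈ range n, (r - i) := by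
  rw [← smeval_descPochhammer_eq_prod, Ring.descPochhammer_eq_factorial_smul_choose, nsmul_eq_mul]

theorem eq_prod_of_mk_eq_binomialSeries {a : ℕ} (ha : 1 ≤ a) {b : ℝ} (hb : 0 < b) {f : ℕ → ℝ}
    (hf : PowerSeries.mk (fun n => if n = 0 then 0 else f n / (n.factorial : ℝ)) =
      PowerSeries.C b⁻¹ *
        (PowerSeries.rescale (-(a * b)) (PowerSeries.binomialSeries ℝ (-(1 / a) : ℝ)) - 1))
    (n : ℕ) : f (n + 1) = ∏ i ∈ range n, (b * (1 + a) + a * b * i) := by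
  have ha' : (a : ℝ) ≠ 0 := by exact_mod_cast (by omega : a ≠ 0)
  have h := congrArg (PowerSeries.coeff (n + 1)) hf
  rw [PowerSeries.coeff_mk, if_neg (Nat.succ_ne_zero n), PowerSeries.coeff_C_mul, map_sub,
    PowerSeries.coeff_rescale, PowerSeries.binomialSeries_coeff, PowerSeries.coeff_one,
    if_neg (Nat.succ_ne_zero n), sub_zero, smul_eq_mul, mul_one,
    div_eq_iff (by exact_mod_cast (n + 1).factorial_ne_zero)] at h
  have h2 := factorial_mul_choose_eq_prod (-(1 / a) : ℝ) (n + 1)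
  have h3 : (-(a * b) : ℝ) ^ (n + 1) * ∏ i ∈ range (n + 1), (-(1 / a) - i : ℝ)
      = ∏ i ∈ range (n + 1), (b + a * b * i) := by
    rw [← card_range (n + 1), ← prod_const, card_range, ← prod_mul_distrib]
    refine prod_congr rfl fun i _ => ?_
    field_simp
    ring
  rw [prod_range_succ' (fun i : ℕ => b + a * b * i)] at h3
  have h4 : f (n + 1) = b⁻¹ * ((∏ i ∈ range n, (b + a * b * (i + 1 : ℕ))) * b) := by
    rw [h, ← h2] at *
    push_cast at h3 ⊢
    linear_combination b⁻¹ * h3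
  rw [h4, mul_comm _ b, inv_mul_cancel_left₀ hb.ne']
  refine prod_congr rfl fun i _ => ?_
  push_cast
  ring

theorem eq_pow_of_mk_eq_exp {b : ℝ} (hb : 0 < b) {f : ℕ → ℝ}
    (hf : PowerSeries.mk (fun n => if n = 0 then 0 else f n / (n.factorial : ℝ)) =
      PowerSeries.C b⁻¹ * (PowerSeries.rescale b (PowerSeries.exp ℝ) - 1)) (n : ℕ) :
    f (n + 1) = b ^ n := by
  have h := congrArg (PowerSeries.coeff (n + 1)) hf
  have hfac : ((n + 1).factorial : ℝ) ≠ 0 := by exact_mod_cast (n + 1).factorial_ne_zero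
  rw [PowerSeries.coeff_mk, if_neg (Nat.succ_ne_zero n), PowerSeries.coeff_C_mul, map_sub,
    PowerSeries.coeff_rescale, PowerSeries.coeff_exp, PowerSeries.coeff_one,
    if_neg (Nat.succ_ne_zero n), sub_zero, div_eq_iff hfac] at h
  rw [h]
  simp only [map_div₀, map_one, map_natCast]
  field_simp
  ring

/-- The factorial moments of the Poisson distribution. -/
theorem hasSum_poisson_descFactorial (x : ℝ) (j : ℕ) :
    HasSum (fun K : ℕ => Real.exp (-x) * x ^ K / K.factorial * K.descFactorial j) (x ^ j) := by
  have h0 : HasSum (fun K : ℕ => x ^ K / (K.factorial : ℝ)) (Real.exp x) := by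
    rw [Real.exp_eq_exp_ℝ]
    exact NormedSpace.expSeries_div_hasSum_exp x
  have h1 : HasSum (fun K : ℕ => Real.exp (-x) * x ^ (K + j) / (K + j).factorial *
      (K + j).descFactorial j) (x ^ j) := by
    have hx : Real.exp (-x) * x ^ j * Real.exp x = x ^ j := by
      rw [mul_right_comm, ← Real.exp_add]
      simp
    have h2 := h0.mul_left (Real.exp (-x) * x ^ j)
    rw [hx] at h2
    refine Eq.mp (congrArg (fun f => HasSum f (x ^ j)) (funext fun K => ?_)) h2
    have hfac : ((K + j).factorial : ℝ) = K.factorial * (K + j).descFactorial j := by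
      have := Nat.factorial_mul_descFactorial (Nat.le_add_left j K)
      rw [Nat.add_sub_cancel] at this
      exact_mod_cast this.symm
    have hK : (K.factorial : ℝ) ≠ 0 := by exact_mod_cast K.factorial_ne_zero
    have hd : ((K + j).descFactorial j : ℝ) ≠ 0 := by
      have : (K + j).descFactorial j ≠ 0 :=
        fun hz => absurd (Nat.descFactorial_eq_zero_iff_lt.1 hz) (by omega)
      exact_mod_cast this
    rw [hfac]
    field_simp
    ring
  have h2 := (hasSum_nat_add_iff
    (f := fun K : ℕ => Real.exp (-x) * x ^ K / K.factorial * K.descFactorial j) j).1 h1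
  rwa [sum_eq_zero, add_zero] at h2
  intro i hi
  rw [Nat.descFactorial_eq_zero_iff_lt.2 (mem_range.1 hi)]
  simp

/-- A Poisson mixture of rising products is a generalized Lah polynomial. -/
theorem hasSum_poisson_prod (a : ℕ) (b d x : ℝ) (n : ℕ) :
    HasSum (fun K : ℕ => Real.exp (-x) * x ^ K / K.factorial *
      ∏ r ∈ range n, (b * K + a * b * d + a * b * r)) ((genLahPoly a b b d 0 n).eval x) := by
  have hdeg : (genLahPoly a b b d 0 n).natDegree < n + 1 := Nat.lt_succ_of_le
    (Polynomial.natDegree_le_iff_coeff_eq_zero.2 fun k hk => coeff_genLahPoly_eq_zero n k hk)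
  rw [Polynomial.eval_eq_sum_range' hdeg]
  have h := hasSum_sum (s := range (n + 1)) fun j _ =>
    (hasSum_poisson_descFactorial x j).mul_left ((genLahPoly a b b d 0 n).coeff j)
  refine Eq.mp (congrArg (fun f => HasSum f _) (funext fun K => ?_)) h
  symm
  rw [prod_congr rfl fun (r : ℕ) _ => (by ring : b * K + a * b * d + a * b * r
    = b * K + a * b * r + a * b * d), ← sum_coeff_mul_descFactorial a b d n K (Nat.lt_succ_self n),
    mul_sum]
  exact sum_congr rfl fun j _ => by ring

theorem coeff_genLahPoly_nonneg {a : ℕ} {b d l : ℝ} (hb : 0 ≤ b) (hd : 0 ≤ d) (hl : 0 ≤ l)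
    (n k : ℕ) : 0 ≤ (genLahPoly a b b d l n).coeff k :=
  (minorsMem_coeff_genLahPoly (N := Subsemiring.nonneg ℝ) a (one_mul b) (zero_le_one (α := ℝ)) hb hd hl).apply
    n k

theorem sum_genLahPoly_mul_pow (a : ℕ) (b d l s r : ℝ) (n : ℕ) (hr : r ≠ 0) :
    ∑ k ∈ range (n + 1), (genLahPoly a b b d l n).coeff k * s ^ k * r ^ (n - k)
      = r ^ n * (genLahPoly a b b d 0 n).eval (s / r + l) := by
  have h1 : (genLahPoly a b b d 0 n).eval (s / r + l) = (genLahPoly a b b d l n).eval (s / r) := by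
    have := genLahPoly_comp a b b d 0 l n
    rw [zero_add] at this
    rw [← this, Polynomial.eval_comp]
    simp
  have hdeg : (genLahPoly a b b d l n).natDegree < n + 1 := Nat.lt_succ_of_le
    (Polynomial.natDegree_le_iff_coeff_eq_zero.2 fun k hk => coeff_genLahPoly_eq_zero n k hk)
  rw [h1, Polynomial.eval_eq_sum_range' hdeg, mul_sum]
  refine sum_congr rfl fun k hk => ?_
  have hrn : r ^ n = r ^ (n - k) * r ^ k := by
    rw [← pow_add, Nat.sub_add_cancel (Nat.lt_succ_iff.1 (mem_range.1 hk))]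
  rw [hrn, div_pow]
  field_simp

theorem sum_genLahPoly_mul_zero_pow (a : ℕ) (b d l s : ℝ) (n : ℕ) :
    ∑ k ∈ range (n + 1), (genLahPoly a b b d l n).coeff k * s ^ k * 0 ^ (n - k) = (b * s) ^ n := by
  rw [sum_eq_single n, coeff_genLahPoly_self, Nat.sub_self, mul_pow]
  · ring
  · intro k hk hkn
    rw [mem_range] at hk
    rw [zero_pow (by omega), mul_zero]
  · simp

/-- For fixed `s, r ≥ 0` the form `∑ T_{n,k} s^k r^{n-k}` is itself an `n`-th moment. If `r ≠ 0` it
equals `r^n` times the `l = 0` polynomial at `s/r + l`: draw `K` from the Poisson law of mean `s/r +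
l`, then a variable with law `γ K`, and multiply by `r`. If `r = 0` it is `(bs)^n`, the moment of a
point mass. Integration over `μ × ν` gives `z_n`. -/
theorem preservesSM_genLahPoly {a : ℕ} {b d l : ℝ} (hb : 0 ≤ b) (hd : 0 ≤ d) (hl : 0 ≤ l) :
    PreservesSM fun n k => (genLahPoly a b b d l n).coeff k := by
  intro x y hx hy
  have hT := fun n k => coeff_genLahPoly_nonneg (a := a) hb hd hl n k
  obtain ⟨μ, hμ⟩ := hx.exists_lintegral
  obtain ⟨ν, hν⟩ := hy.exists_lintegral
  have hfin : ∀ (ρ : Measure ℝ≥0) (α : ℝ), ∫⁻ x, (x : ℝ≥0∞) ^ 0 ∂ρ = ENNReal.ofReal α →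
      IsFiniteMeasure ρ := fun ρ α h => ⟨by
    simp only [pow_zero, lintegral_const, one_mul] at h
    rw [h]
    exact ENNReal.ofReal_lt_top⟩
  have := hfin μ _ (hμ 0)
  have := hfin ν _ (hν 0)
  have hγ := fun K : ℕ => exists_lintegral_eq_prod (h := b * K + a * b * d) (a := a * b)
    (by positivity) (by positivity)
  choose γ hγfin hγ using hγ
  let p : ℕ → ℝ≥0 × ℝ≥0 → ℝ := fun K z =>
    Real.exp (-((z.1 : ℝ) / z.2 + l)) * ((z.1 : ℝ) / z.2 + l) ^ K / K.factorial
  have hp0 : ∀ K z, 0 ≤ p K z := fun K z => by positivity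
  have hS : MeasurableSet {z : ℝ≥0 × ℝ≥0 | z.2 = 0} := measurable_snd (measurableSet_singleton 0)
  -- The weights `w` and `v` split the plane into `r ≠ 0` and `r = 0`, so the junk value of `s / 0`
  -- never contributes; `κ₁` and `κ₂` are the resulting two mixtures.
  let w : ℕ → ℝ≥0 × ℝ≥0 → ℝ≥0∞ := fun K z => if z.2 = 0 then 0 else ENNReal.ofReal (p K z)
  have hw : ∀ K, Measurable (w K) := fun K => Measurable.ite hS (by fun_prop) (by fun_prop)
  let v : ℝ≥0 × ℝ≥0 → ℝ≥0∞ := fun z => if z.2 = 0 then 1 else 0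
  have hv : Measurable v := Measurable.ite hS (by fun_prop) (by fun_prop)
  let κ₁ : Measure ℝ≥0 := Measure.sum fun K =>
    ((((μ.prod ν).withDensity (w K)).prod (γ K)).map fun z => z.1.2 * z.2)
  let κ₂ : Measure ℝ≥0 := ((μ.prod ν).withDensity v).map fun z => b.toNNReal * z.1
  refine isStieltjesMoment_of_lintegral (fun n => sum_nonneg fun k _ =>
    mul_nonneg (mul_nonneg (hT n k) (hx.nonneg k)) (hy.nonneg _)) (κ₁ + κ₂) fun n => ?_
  have h1 : ∫⁻ x, (x : ℝ≥0∞) ^ n ∂κ₁ = ∫⁻ z, ∑' K, w K z * (z.2 : ℝ≥0∞) ^ n *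
      ENNReal.ofReal (∏ i ∈ range n, (b * K + a * b * d + a * b * i)) ∂(μ.prod ν) := by
    rw [lintegral_tsum fun K => by fun_prop, lintegral_sum_measure]
    refine tsum_congr fun K => ?_
    rw [lintegral_map (by fun_prop) (by fun_prop), lintegral_mul_const _ (by fun_prop), ← hγ]
    simp only [ENNReal.coe_mul, mul_pow]
    rw [lintegral_prod_mul (f := fun z : ℝ≥0 × ℝ≥0 => (z.2 : ℝ≥0∞) ^ n)
      (g := fun y : ℝ≥0 => (y : ℝ≥0∞) ^ n) (by fun_prop) (by fun_prop),
      lintegral_withDensity_eq_lintegral_mul _ (hw K) (by fun_prop)]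
    rfl
  have h2 : ∫⁻ x, (x : ℝ≥0∞) ^ n ∂κ₂
      = ∫⁻ z, v z * ((b.toNNReal * z.1 : ℝ≥0) : ℝ≥0∞) ^ n ∂(μ.prod ν) := by
    rw [lintegral_map (by fun_prop) (by fun_prop),
      lintegral_withDensity_eq_lintegral_mul _ hv (by fun_prop)]
    rfl
  have h3 : ∀ z : ℝ≥0 × ℝ≥0, (∑' K, w K z * (z.2 : ℝ≥0∞) ^ n *
      ENNReal.ofReal (∏ i ∈ range n, (b * K + a * b * d + a * b * i)))
      + v z * ((b.toNNReal * z.1 : ℝ≥0) : ℝ≥0∞) ^ n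
      = ∑ k ∈ range (n + 1), ENNReal.ofReal ((genLahPoly a b b d l n).coeff k) *
        ((z.1 : ℝ≥0∞) ^ k * (z.2 : ℝ≥0∞) ^ (n - k)) := by
    rintro ⟨s, r⟩
    have hR : ∑ k ∈ range (n + 1), ENNReal.ofReal ((genLahPoly a b b d l n).coeff k) *
        ((s : ℝ≥0∞) ^ k * (r : ℝ≥0∞) ^ (n - k)) = ENNReal.ofReal (∑ k ∈ range (n + 1),
        (genLahPoly a b b d l n).coeff k * (s : ℝ) ^ k * (r : ℝ) ^ (n - k)) := by
      rw [ENNReal.ofReal_sum_of_nonneg fun k _ => by have := hT n k; positivity]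
      refine sum_congr rfl fun k _ => ?_
      rw [mul_assoc, ENNReal.ofReal_mul (hT n k), ENNReal.ofReal_mul (by positivity),
        ENNReal.ofReal_pow s.coe_nonneg, ENNReal.ofReal_pow r.coe_nonneg, ENNReal.ofReal_coe_nnreal,
        ENNReal.ofReal_coe_nnreal]
    rw [hR]
    by_cases hr : r = 0
    · subst hr
      simp only [w, v, if_true, zero_mul, tsum_zero, zero_add, one_mul, NNReal.coe_zero]
      rw [sum_genLahPoly_mul_zero_pow, ENNReal.ofReal_pow (by positivity),
        ENNReal.ofReal_mul hb, ENNReal.ofReal_coe_nnreal, ENNReal.coe_mul]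
      rfl
    · have hr' : (r : ℝ) ≠ 0 := by exact_mod_cast hr
      have hpr : ∀ K : ℕ, 0 ≤ ∏ i ∈ range n, (b * K + a * b * d + a * b * i) :=
        fun K => prod_nonneg fun i _ => by positivity
      have hs := (hasSum_poisson_prod a b d (s / r + l) n).mul_left ((r : ℝ) ^ n)
      rw [sum_genLahPoly_mul_pow _ _ _ _ _ _ _ hr', ← hs.tsum_eq,
        ENNReal.ofReal_tsum_of_nonneg _ hs.summable]
      · simp only [w, v, if_neg hr, zero_mul, add_zero]
        refine tsum_congr fun K => ?_
        rw [ENNReal.ofReal_mul (by positivity), ENNReal.ofReal_mul (hp0 K (s, r)),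
          ENNReal.ofReal_pow r.coe_nonneg, ENNReal.ofReal_coe_nnreal]
        ring
      · intro K
        have := hpr K
        have := hp0 K (s, r)
        positivity
  rw [lintegral_add_measure, h1, h2, ← lintegral_add_right _ (by fun_prop), lintegral_congr h3,
    lintegral_finsetSum _ (fun k _ => by fun_prop),
    ENNReal.ofReal_sum_of_nonneg fun k _ => mul_nonneg (mul_nonneg (hT n k) (hx.nonneg k))
      (hy.nonneg _)]
  refine sum_congr rfl fun k _ => ?_
  rw [lintegral_const_mul _ (by fun_prop), lintegral_prod_mul
    (f := fun s : ℝ≥0 => (s : ℝ≥0∞) ^ k) (g := fun r : ℝ≥0 => (r : ℝ≥0∞) ^ (n - k))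
    (by fun_prop) (by fun_prop), hμ, hν, mul_assoc, ENNReal.ofReal_mul (hT n k),
    ENNReal.ofReal_mul (hx.nonneg k)]

end StieltjesMoments

/-! ### Branched continued fractions by the Euler–Gauss method -/

section BranchedFraction

variable {R : Type*} [CommRing R]

theorem dvd_prod_sub_prod {ι : Type*} (s : Finset ι) {f g : ι → R} {x : R}
    (h : ∀ i ∈ s, x ∣ f i - g i) : x ∣ ∏ i ∈ s, f i - ∏ i ∈ s, g i := by
  classical
  induction s using Finset.induction_on with
  | empty => simp
  | insert i s hi ih =>
    rw [prod_insert hi, prod_insert hi,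
      show f i * ∏ j ∈ s, f j - g i * ∏ j ∈ s, g j
        = (f i - g i) * ∏ j ∈ s, f j + g i * (∏ j ∈ s, f j - ∏ j ∈ s, g j) by ring]
    exact dvd_add (Dvd.dvd.mul_right (h i (mem_insert_self i s)) _)
      (Dvd.dvd.mul_left (ih fun j hj => h j (mem_insert_of_mem hj)) _)

theorem constantCoeff_branchedTrunc (m : ℕ) (α : ℕ → R) (N k : ℕ) :
    PowerSeries.constantCoeff (branchedTrunc m α N k) = 1 := by
  cases N with
  | zero => simp [branchedTrunc]
  | succ N => simp [branchedTrunc]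

/-- The Euler–Gauss recurrence method for branched continued fractions. -/
theorem isBranchedSFraction_of_recurrence {m : ℕ} {α : ℕ → R} {G : ℕ → PowerSeries R}
    (h0 : G 0 = 1) (hc : ∀ k, PowerSeries.constantCoeff (G k) = 1)
    (hrec : ∀ k, G (k + 1) - G k
      = PowerSeries.C (α (k + m)) * PowerSeries.X * G (k + m + 1)) :
    IsBranchedSFraction m α (G 1) := by
  -- The ratios `f k = G (k+1) / G k` telescope, `∏_{i=1}^m f (k+i) = G (k+m+1) / G (k+1)`, so the
  -- recurrence for `G` becomes the fixed-point equation of the fraction.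
  let f : ℕ → PowerSeries R := fun k => G (k + 1) * PowerSeries.invOfUnit (G k) 1
  have hinv : ∀ k, G k * PowerSeries.invOfUnit (G k) 1 = 1 := fun k =>
    PowerSeries.mul_invOfUnit _ _ (by rw [hc]; rfl)
  have hf : ∀ k, f k * G k = G (k + 1) := fun k => by
    rw [mul_assoc, mul_comm (PowerSeries.invOfUnit _ _), hinv, mul_one]
  have hprod : ∀ k j, (∏ i ∈ Icc 1 j, f (k + i)) * G (k + 1) = G (k + j + 1) := by
    intro k j
    induction j with
    | zero => simp
    | succ j ih =>
      rw [prod_Icc_succ_top (by omega), mul_right_comm, ih, mul_comm]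
      exact hf (k + (j + 1))
  have hfD : ∀ k, f k * (1 - PowerSeries.C (α (k + m)) * PowerSeries.X *
      ∏ i ∈ Icc 1 m, f (k + i)) = 1 := by
    intro k
    have h1 : f k * (1 - PowerSeries.C (α (k + m)) * PowerSeries.X *
      ∏ i ∈ Icc 1 m, f (k + i)) * G k = G k := by
      linear_combination (1 - PowerSeries.C (α (k + m)) * PowerSeries.X *
        ∏ i ∈ Icc 1 m, f (k + i)) * hf k + hrec k -
        PowerSeries.C (α (k + m)) * PowerSeries.X * hprod k m
    calc _ = f k * (1 - PowerSeries.C (α (k + m)) * PowerSeries.X *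
          ∏ i ∈ Icc 1 m, f (k + i)) * (G k * PowerSeries.invOfUnit (G k) 1) := by
          rw [hinv, mul_one]
      _ = 1 := by rw [← mul_assoc, h1, hinv]
  -- Each level carries a factor `X`, so each further level of truncation gains one order of
  -- agreement.
  have happrox : ∀ N k, (PowerSeries.X : PowerSeries R) ^ (N + 1) ∣
      branchedTrunc m α N k - f k := by
    intro N
    induction N with
    | zero =>
      intro k
      rw [zero_add, pow_one, PowerSeries.X_dvd_iff, map_sub, constantCoeff_branchedTrunc, map_mul,
        hc]
      simp
    | succ N ih =>
      intro k
      have hD : branchedTrunc m α (N + 1) k * (1 - PowerSeries.C (α (k + m)) * PowerSeries.X *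
          ∏ i ∈ Icc 1 m, branchedTrunc m α N (k + i)) = 1 := by
        rw [mul_comm]
        exact PowerSeries.mul_invOfUnit _ _ (by simp)
      have hdiff : branchedTrunc m α (N + 1) k - f k
          = branchedTrunc m α (N + 1) k * f k * PowerSeries.C (α (k + m)) * (PowerSeries.X *
            (∏ i ∈ Icc 1 m, branchedTrunc m α N (k + i) - ∏ i ∈ Icc 1 m, f (k + i))) := by
        linear_combination f k * hD - branchedTrunc m α (N + 1) k * hfD k
      rw [hdiff, pow_succ']
      exact Dvd.dvd.mul_left (mul_dvd_mul_left _ (dvd_prod_sub_prod _ fun i _ => ih (k + i))) _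
  have hf0 : f 0 = G 1 := by
    have := hf 0
    rwa [h0, mul_one] at this
  intro n
  refine ⟨n, fun N hN => ?_⟩
  have := PowerSeries.X_pow_dvd_iff.1 (happrox N 0) n (by omega)
  rwa [map_sub, sub_eq_zero, hf0] at this

open Polynomial

theorem coeff_oneAddDeriv_pow_of_degree (u : R) {p : R[X]} {n : ℕ} (hp : ∀ k, n < k → p.coeff k = 0)
    (r : ℕ) : (∀ k, n < k → ((oneAddDeriv u ^ r) p).coeff k = 0) ∧
      ((oneAddDeriv u ^ r) p).coeff n = p.coeff n := by
  induction r with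
  | zero => exact ⟨hp, rfl⟩
  | succ r ih =>
    rw [pow_succ', Module.End.mul_apply]
    refine ⟨fun k hk => ?_, ?_⟩
    · rw [coeff_oneAddDeriv, ih.1 k hk, ih.1 (k + 1) (by omega)]
      ring
    · rw [coeff_oneAddDeriv, ih.2, ih.1 (n + 1) (by omega)]
      ring

/-- The series of the Euler–Gauss recurrence, indexed by block `j` and position `r`. -/
noncomputable def lahSeries (a : ℕ) (b u : R) (j r : ℕ) : PowerSeries R :=
  PowerSeries.mk fun n => ((oneAddDeriv b ^ r) (genLahPoly a b 1 0 u (n + j))).coeff j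

theorem constantCoeff_lahSeries (a : ℕ) (b u : R) (j r : ℕ) :
    PowerSeries.constantCoeff (lahSeries a b u j r) = 1 := by
  rw [← PowerSeries.coeff_zero_eq_constantCoeff_apply, lahSeries, PowerSeries.coeff_mk, zero_add,
    (coeff_oneAddDeriv_pow_of_degree b (fun k hk => coeff_genLahPoly_eq_zero j k hk) r).2,
    coeff_genLahPoly_self, one_pow]

/-- Applying `E` once more adds `b (j + 1)` times coefficient `j + 1`. Since `n + j = (n - 1) + (j +
1)`, this is the next block shifted by one power of `t`. -/
theorem lahSeries_succ_right (a : ℕ) (b u : R) (j r : ℕ) :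
    lahSeries a b u j (r + 1) - lahSeries a b u j r
      = PowerSeries.C ((j + 1 : ℕ) * b) * PowerSeries.X * lahSeries a b u (j + 1) r := by
  ext n
  rw [map_sub, mul_assoc, PowerSeries.coeff_C_mul, lahSeries, lahSeries, PowerSeries.coeff_mk,
    PowerSeries.coeff_mk, pow_succ', Module.End.mul_apply, coeff_oneAddDeriv]
  rcases n with _ | n
  · rw [PowerSeries.coeff_zero_X_mul,
      (coeff_oneAddDeriv_pow_of_degree b (fun k hk => coeff_genLahPoly_eq_zero _ k hk) r).1
        (j + 1) (by omega)]
    ring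
  · rw [PowerSeries.coeff_succ_X_mul, lahSeries, PowerSeries.coeff_mk,
      show n + (j + 1) = n + 1 + j by omega]
    push_cast
    ring

theorem genLahPoly_succ_eq_mul (a : ℕ) (b u : R) (n : ℕ) :
    genLahPoly a b 1 0 u (n + 1)
      = C 1 * (X + C u) * (oneAddDeriv b ^ (a + 1)) (genLahPoly a b 1 0 u n) := by
  rw [genLahPoly_succ_eq_lahProd a (mul_one b), lahProd, mul_zero, zero_smul, zero_add, mul_assoc,
    ← pow_succ', Module.End.mul_apply, mulOp_apply]

/-- Passage to the next block: for `c = 1`, `d = 0` one has `L_{n+1} = (X + u) E^{a+1} L_n`. The `X`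
term supplies the end of block `j`, the `u` term the shifted series. -/
theorem lahSeries_zero_right_succ (a : ℕ) (b u : R) (j : ℕ) :
    lahSeries a b u (j + 1) 0 - lahSeries a b u j (a + 1)
      = PowerSeries.C u * PowerSeries.X * lahSeries a b u (j + 1) (a + 1) := by
  ext n
  rw [map_sub, mul_assoc, PowerSeries.coeff_C_mul, lahSeries, lahSeries, PowerSeries.coeff_mk,
    PowerSeries.coeff_mk, pow_zero, Module.End.one_apply, ← add_assoc, genLahPoly_succ_eq_mul,
    coeff_C_mul_X_add_C_mul]
  rcases n with _ | n
  · rw [PowerSeries.coeff_zero_X_mul,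
      (coeff_oneAddDeriv_pow_of_degree b (fun k hk => coeff_genLahPoly_eq_zero _ k hk) _).1
        (j + 1) (by omega)]
    ring
  · rw [PowerSeries.coeff_succ_X_mul, lahSeries, PowerSeries.coeff_mk,
      show n + (j + 1) = n + 1 + j by omega]
    ring

theorem lahSeries_zero_zero (a : ℕ) (b u : R) :
    lahSeries a b u 0 0 - 1 = PowerSeries.C u * PowerSeries.X * lahSeries a b u 0 (a + 1) := by
  ext n
  rw [map_sub, mul_assoc, PowerSeries.coeff_C_mul]
  rcases n with _ | n
  · rw [PowerSeries.coeff_zero_X_mul]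
    simp [lahSeries, genLahPoly]
  · rw [PowerSeries.coeff_succ_X_mul, lahSeries, lahSeries, PowerSeries.coeff_mk,
      PowerSeries.coeff_mk, pow_zero, Module.End.one_apply, add_zero, add_zero,
      genLahPoly_succ_eq_mul, coeff_zero_C_mul_X_add_C_mul, PowerSeries.coeff_one,
      if_neg (Nat.succ_ne_zero n)]
    ring

theorem isBranchedSFraction_genLahPoly (a : ℕ) (b u : R) :
    IsBranchedSFraction (a + 1) (branchedCoeffs (a + 1) u b)
      (PowerSeries.mk fun n => (genLahPoly a b 1 0 u n).coeff 0) := by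
  -- The pairs `(j, r)` with `r ≤ a + 1` are listed in order after `G 0 = 1`. The block length `a +
  -- 2 = m + 1` is the period of the coefficient pattern.
  let G : ℕ → PowerSeries R := fun k =>
    if k = 0 then 1 else lahSeries a b u ((k - 1) / (a + 2)) ((k - 1) % (a + 2))
  have hG : ∀ j r, r < a + 2 → G ((a + 2) * j + r + 1) = lahSeries a b u j r := by
    intro j r hr
    simp only [G, Nat.succ_ne_zero, if_false, Nat.add_sub_cancel]
    rw [Nat.mul_add_div (by omega), Nat.div_eq_of_lt hr, add_zero, Nat.mul_add_mod,
      Nat.mod_eq_of_lt hr]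
  have hG1 : G 1 = PowerSeries.mk fun n => (genLahPoly a b 1 0 u n).coeff 0 := hG 0 0 (by omega)
  rw [← hG1]
  refine isBranchedSFraction_of_recurrence rfl (fun k => ?_) fun k => ?_
  · rcases k with _ | k
    · simp [G]
    · simp only [G, Nat.succ_ne_zero, if_false]
      exact constantCoeff_lahSeries _ _ _ _ _
  · obtain ⟨j, r, hr, rfl⟩ : ∃ j r, r < a + 2 ∧ k = (a + 2) * j + r :=
      ⟨k / (a + 2), k % (a + 2), Nat.mod_lt _ (by omega), (Nat.div_add_mod k _).symm⟩
    rw [hG j r hr, branchedCoeffs, Nat.add_sub_cancel]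
    change _ = PowerSeries.C (if ((a + 2) * j + r) % (a + 2) = 0 then u
      else ((((a + 2) * j + r) / (a + 2) + 1 : ℕ) : R) * b) * _ * _
    rw [Nat.mul_add_mod, Nat.mod_eq_of_lt hr, Nat.mul_add_div (by omega), Nat.div_eq_of_lt hr,
      add_zero]
    rcases r with _ | r
    · rw [if_pos rfl, add_zero, hG j (a + 1) (by omega)]
      rcases j with _ | j
      · exact lahSeries_zero_zero a b u
      · rw [show (a + 2) * (j + 1) = (a + 2) * j + (a + 1) + 1 by ring, hG j (a + 1) (by omega)]
        exact lahSeries_zero_right_succ a b u j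
    · rw [if_neg (Nat.succ_ne_zero r), ← add_assoc, hG j r (by omega),
        show (a + 2) * j + r + 1 + (a + 1) + 1 = (a + 2) * (j + 1) + r + 1 by ring,
        hG (j + 1) r (by omega)]
      exact lahSeries_succ_right a b u j r

/-- Rescaling columns by `c^k` normalizes `c` to 1, which makes the series of the Euler–Gauss
recurrence have constant term 1. -/
theorem coeff_genLahPoly_eq_pow_mul (a : ℕ) (b c l : R) (n k : ℕ) :
    (genLahPoly a b c 0 l n).coeff k = c ^ k * (genLahPoly a b 1 0 (c * l) n).coeff k := by
  have hl := (isGenLahTriangle_genLahPoly (a := a) (b := b) (c := c) (d := 0) (l := l))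
  have hr := (isGenLahTriangle_genLahPoly (a := a) (b := b) (c := 1) (d := 0) (l := c * l))
  induction n generalizing k with
  | zero =>
    rcases k with _ | k
    · simp [genLahPoly]
    · simp [genLahPoly, coeff_one]
  | succ n ih =>
    rcases k with _ | k
    · rw [hl.rec_zero, hr.rec_zero, ih, ih]
      ring
    · rw [hl.rec_succ, hr.rec_succ, ih, ih, ih]
      ring

theorem map_genLahPoly {S : Type*} [CommRing S] (φ : R →+* S) (a : ℕ) (b c d l : R) (n : ℕ) :
    (genLahPoly a b c d l n).map φ = genLahPoly a (φ b) (φ c) (φ d) (φ l) n := by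
  induction n with
  | zero => simp [genLahPoly]
  | succ n ih => simp [genLahPoly, ← ih, derivative_map]

/-- Turns a row polynomial into a column-0 entry over `R[X]`, so that the continued fraction need
only be proved for column 0. -/
theorem genLahPoly_eq_coeff_zero (a : ℕ) (b c d l : R) (n : ℕ) :
    genLahPoly a b c d l n = (genLahPoly a (C b) (C c) (C d) (X + C l) n).coeff 0 := by
  rw [add_comm, ← eval_genLahPoly, ← map_genLahPoly, eval_map, eval₂_C_X]

theorem IsGenLahTriangle.isBranchedSFraction {a : ℕ} {b c l : R} {T : ℕ → ℕ → R}
    (hT : IsGenLahTriangle a b c 0 l T) :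
    IsBranchedSFraction (a + 1) (branchedCoeffs (a + 1) (C c * (X + C l)) (C b))
      (PowerSeries.mk fun n => rowPoly T n) := by
  have h := isBranchedSFraction_genLahPoly a (C b) (C c * (X + C l))
  convert h using 3 with n
  rw [hT.rowPoly_eq, genLahPoly_eq_coeff_zero, C_0, coeff_genLahPoly_eq_pow_mul, pow_zero, one_mul]

theorem IsGenLahTriangle.isBranchedSFraction_column_zero {a : ℕ} {b c l : R} {T : ℕ → ℕ → R}
    (hT : IsGenLahTriangle a b c 0 l T) :
    IsBranchedSFraction (a + 1) (branchedCoeffs (a + 1) (c * l) b)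
      (PowerSeries.mk fun n => T n 0) := by
  have h := isBranchedSFraction_genLahPoly a b (c * l)
  convert h using 3 with n
  rw [hT.eq_coeff, coeff_genLahPoly_eq_pow_mul, pow_zero, one_mul]

end BranchedFraction

/-! ### Real zeros and Pólya frequency rows -/

section RealRoots

open Polynomial

/-- A real polynomial with a nonnegative constant factor and linear factors `X + s`, `s ≥ 0`. -/
def HasNonposRoots (p : ℝ[X]) : Prop :=
  ∃ e : ℝ, 0 ≤ e ∧ ∃ s : Multiset ℝ, (∀ x ∈ s, 0 ≤ x) ∧ p = C e * (s.map fun x => X + C x).prod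

theorem hasNonposRoots_C {e : ℝ} (he : 0 ≤ e) : HasNonposRoots (C e) :=
  ⟨e, he, 0, by simp, by simp⟩

theorem HasNonposRoots.comp_X_add_C {p : ℝ[X]} (hp : HasNonposRoots p) {l : ℝ} (hl : 0 ≤ l) :
    HasNonposRoots (p.comp (X + C l)) := by
  obtain ⟨e, he, s, hs, rfl⟩ := hp
  refine ⟨e, he, s.map fun x => l + x, fun x hx => ?_, ?_⟩
  · obtain ⟨y, hy, rfl⟩ := Multiset.mem_map.1 hx
    exact add_nonneg hl (hs y hy)
  · rw [mul_comp, C_comp, multiset_prod_comp, Multiset.map_map, Multiset.map_map]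
    simp [add_assoc]

theorem HasNonposRoots.im_eq_zero {p : ℝ[X]} (hp : HasNonposRoots p) (h0 : p ≠ 0) {z : ℂ}
    (hz : aeval z p = 0) : z.im = 0 := by
  obtain ⟨e, he, s, hs, rfl⟩ := hp
  have he0 : e ≠ 0 := by
    rintro rfl
    simp at h0
  rw [map_mul, aeval_C, map_multiset_prod, Multiset.map_map] at hz
  rcases mul_eq_zero.1 hz with h | h
  · exact absurd (by simpa using h) he0
  · obtain ⟨x, hx, hx0⟩ := Multiset.mem_map.1 (Multiset.prod_eq_zero_iff.1 h)
    have : z + x = 0 := by simpa using hx0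
    simpa using congrArg Complex.im this

/-- Multiplication by each factor `X + x`, and by the constant, is bidiagonal. The matrix of
multiplication by `p` is the transposed Toeplitz matrix of its coefficients. -/
theorem HasNonposRoots.minorsMem {p : ℝ[X]} (hp : HasNonposRoots p) :
    MinorsMem (Subsemiring.nonneg ℝ) (opMat (mulOp p)) := by
  obtain ⟨e, he, s, hs, rfl⟩ := hp
  have hmul : ∀ p q : ℝ[X], mulOp (p * q) = mulOp p * mulOp q := fun p q =>
    LinearMap.ext fun r => mul_assoc p q r
  have hC : mulOp (C e) = e • (1 : Module.End ℝ ℝ[X]) :=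
    LinearMap.ext fun r => (smul_eq_C_mul e).symm
  rw [hmul]
  refine MinorsMem.opMat_mul ?_ ?_
  · induction s using Multiset.induction_on with
    | empty =>
      rw [Multiset.map_zero, Multiset.prod_zero, show mulOp (1 : ℝ[X]) = 1 from
        LinearMap.ext fun r => one_mul r]
      exact minorsMem_opMat_one
    | cons x s ih =>
      rw [Multiset.map_cons, Multiset.prod_cons, hmul]
      refine (ih fun y hy => hs y (Multiset.mem_cons_of_mem hy)).opMat_mul ?_
      have hx : 0 ≤ x := hs x (Multiset.mem_cons_self x s)
      have := minorsMem_opMat_C_mul_X_add_C (N := Subsemiring.nonneg ℝ) (c := 1) (l := x)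
        (zero_le_one (α := ℝ)) (by rw [one_mul]; exact hx)
      rwa [C_1, one_mul] at this
  · have hco : ∀ i j, opMat (mulOp (C e)) i j = if i = j then e else 0 := fun i j => by
      rw [opMat, mulOp_apply, coeff_C_mul, coeff_X_pow]
      simp [eq_comm]
    refine MinorsMem.of_bidiagonal (fun i j => ?_) fun i j h1 _ => ?_
    · rw [hco]
      split_ifs
      exacts [he, le_refl (0 : ℝ)]
    · rw [hco, if_neg (Ne.symm h1)]

theorem HasNonposRoots.isPF {p : ℝ[X]} (hp : HasNonposRoots p) : IsPF fun k => p.coeff k := by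
  intro r rows cols hr hc
  have h := hp.minorsMem.transpose r rows cols hr hc
  simp only [opMat, mulOp_apply, coeff_mul_X_pow'] at h
  exact h

/-- `L` is `z p'(z)/p(z) = ∑ z/(z + x)`, and each summand has imaginary part `x Im z / |z + x|²`. -/
theorem exists_log_derivative (s : Multiset ℝ) (hs : ∀ x ∈ s, 0 ≤ x) {z : ℂ} (hz : z.im ≠ 0) :
    ∃ L : ℂ, 0 ≤ L.im * z.im ∧ z * aeval z (derivative (s.map fun x => X + C x).prod)
      = L * aeval z (s.map fun x => X + C x).prod := by
  induction s using Multiset.induction_on with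
  | empty => exact ⟨0, by simp, by simp⟩
  | cons x s ih =>
    obtain ⟨L, hL, hL'⟩ := ih fun y hy => hs y (Multiset.mem_cons_of_mem hy)
    have hx : 0 ≤ x := hs x (Multiset.mem_cons_self x s)
    have hne : z + x ≠ 0 := fun h => hz (by simpa using congrArg Complex.im h)
    refine ⟨z / (z + x) + L, ?_, ?_⟩
    · rw [Complex.add_im, add_mul]
      refine add_nonneg ?_ hL
      have : (z / (z + x)).im * z.im = x * z.im ^ 2 / Complex.normSq (z + x) := by
        rw [Complex.div_im]
        simp only [Complex.add_re, Complex.add_im, Complex.ofReal_re, Complex.ofReal_im]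
        ring
      rw [this]
      exact div_nonneg (mul_nonneg hx (sq_nonneg _)) (Complex.normSq_nonneg _)
    · rw [Multiset.map_cons, Multiset.prod_cons, derivative_mul]
      simp only [derivative_X, derivative_C, add_zero, one_mul, map_add, map_mul,
        aeval_X, aeval_C, Complex.coe_algebraMap]
      field_simp
      linear_combination (z + x) * hL'

/-- Dividing by `p(z)` leaves `γ + cz + bL = 0`. Taking imaginary parts and multiplying by `Im z`
gives a positive term plus a nonnegative one. -/
theorem HasNonposRoots.im_eq_zero_of_step {p : ℝ[X]} (hp : HasNonposRoots p) (h0 : p ≠ 0)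
    {b c γ : ℝ} (hb : 0 ≤ b) (hc : 0 < c) {z : ℂ}
    (hz : aeval z (C γ * p + C c * X * p + C b * X * derivative p) = 0) : z.im = 0 := by
  by_contra hne
  have hpz : aeval z p ≠ 0 := fun h => hne (hp.im_eq_zero h0 h)
  obtain ⟨e, he, s, hs, rfl⟩ := hp
  obtain ⟨L, hL, hL'⟩ := exists_log_derivative s hs hne
  have h1 : (γ + c * z + b * L) * aeval z (C e * (s.map fun x => X + C x).prod) = 0 := by
    rw [← hz, derivative_C_mul]
    simp only [map_add, map_mul, aeval_X, aeval_C, Complex.coe_algebraMap]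
    linear_combination (-(b : ℂ) * e) * hL'
  have h2 := (mul_eq_zero.1 h1).resolve_right hpz
  have h3 : c * z.im + b * L.im = 0 := by simpa using congrArg Complex.im h2
  have h4 : 0 < c * z.im ^ 2 := by positivity
  have h5 : 0 ≤ b * (L.im * z.im) := mul_nonneg hb hL
  nlinarith [congrArg (· * z.im) h3]

theorem hasNonposRoots_of_forall {p : ℝ[X]} (hlead : 0 ≤ p.leadingCoeff) (h0 : p ≠ 0)
    (hreal : ∀ z : ℂ, aeval z p = 0 → z.im = 0) (hpos : ∀ x : ℝ, 0 < x → p.eval x ≠ 0) :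
    HasNonposRoots p := by
  induction hn : p.natDegree generalizing p with
  | zero =>
    rw [eq_C_of_natDegree_eq_zero hn]
    rw [leadingCoeff, hn] at hlead
    exact hasNonposRoots_C hlead
  | succ n ih =>
    have hdeg : p.degree ≠ 0 := by
      rw [degree_eq_natDegree h0, hn]
      exact_mod_cast Nat.succ_ne_zero n
    obtain ⟨z, hz⟩ := IsAlgClosed.exists_aeval_eq_zero ℂ p hdeg
    have hzr : z = (z.re : ℂ) := Complex.ext rfl (by simpa using hreal z hz)
    have hroot : p.IsRoot z.re := by
      rw [hzr, show ((z.re : ℝ) : ℂ) = algebraMap ℝ ℂ z.re from rfl,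
        aeval_algebraMap_apply_eq_algebraMap_eval] at hz
      simpa using hz
    obtain ⟨q, hq⟩ := dvd_iff_isRoot.2 hroot
    have hq0 : q ≠ 0 := by
      rintro rfl
      exact h0 (by rw [hq, mul_zero])
    have hle : z.re ≤ 0 := not_lt.1 fun h => hpos _ h hroot
    have hqn : q.natDegree = n := by
      rw [hq, natDegree_mul (X_sub_C_ne_zero _) hq0, natDegree_X_sub_C] at hn
      omega
    obtain ⟨e, he, s, hs, hqe⟩ := ih (p := q)
      (by rwa [hq, leadingCoeff_mul, leadingCoeff_X_sub_C, one_mul] at hlead) hq0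
      (fun w hw => hreal w (by rw [hq, map_mul, hw, mul_zero]))
      (fun x hx hx0 => hpos x hx (by rw [hq, eval_mul, hx0, mul_zero])) hqn
    refine ⟨e, he, (-z.re) ::ₘ s, ?_, ?_⟩
    · intro x hx
      rcases Multiset.mem_cons.1 hx with rfl | hx
      · linarith
      · exact hs x hx
    · rw [hq, hqe, Multiset.map_cons, Multiset.prod_cons, C_neg]
      ring

/-- For `c > 0` the induction runs at `l = 0`, where nonnegative coefficients exclude positive
zeros; translation by `l` follows. For `c = 0` all the polynomials are constants, possibly zero. -/
theorem hasNonposRoots_genLahPoly (a : ℕ) {b c d l : ℝ} (hb : 0 ≤ b) (hc : 0 ≤ c) (hd : 0 ≤ d)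
    (hl : 0 ≤ l) (n : ℕ) : HasNonposRoots (genLahPoly a b c d l n) := by
  rcases hc.eq_or_lt with rfl | hc
  · have h : ∀ n, ∃ e : ℝ, 0 ≤ e ∧ genLahPoly a b 0 d l n = C e := by
      intro n
      induction n with
      | zero => exact ⟨1, zero_le_one, by simp [genLahPoly]⟩
      | succ n ih =>
        obtain ⟨e, he, h⟩ := ih
        refine ⟨(a * b * n + a * b * d) * e, by positivity, ?_⟩
        rw [genLahPoly, h, derivative_C, C_mul, C_0]
        ring
    obtain ⟨e, he, h⟩ := h n
    rw [h]
    exact hasNonposRoots_C he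
  have hne : ∀ n, genLahPoly a b c d 0 n ≠ 0 := fun n h => by
    have := coeff_genLahPoly_self (a := a) (b := b) (c := c) (d := d) (l := 0) n
    rw [h, coeff_zero] at this
    exact (pow_pos hc n).ne this
  have hco : ∀ n k, 0 ≤ (genLahPoly a b c d 0 n).coeff k := fun n k =>
    (minorsMem_coeff_genLahPoly (N := Subsemiring.nonneg ℝ) a (div_mul_cancel₀ b hc.ne')
      (div_nonneg hb hc.le) hc.le hd (le_refl (0 : ℝ))).apply n k
  have hzero : ∀ n, HasNonposRoots (genLahPoly a b c d 0 n) := by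
    intro n
    induction n with
    | zero =>
      rw [genLahPoly, ← C_1]
      exact hasNonposRoots_C zero_le_one
    | succ n ih =>
      refine hasNonposRoots_of_forall (hco _ _) (hne _) (fun z hz => ?_) fun x hx => ?_
      · rw [genLahPoly, C_0, add_zero] at hz
        exact ih.im_eq_zero_of_step (hne n) hb hc hz
      · rw [eval_eq_sum_range]
        refine ne_of_gt (sum_pos' (fun k _ => mul_nonneg (hco _ _) (pow_nonneg hx.le k))
          ⟨_, mem_range.2 (Nat.lt_succ_self _), mul_pos ?_ (pow_pos hx _)⟩)
        exact lt_of_le_of_ne (hco _ _) (Ne.symm (leadingCoeff_ne_zero.2 (hne _)))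
  have := (hzero n).comp_X_add_C hl
  rwa [genLahPoly_comp, zero_add] at this

end RealRoots

/-! ### Assembly of the parts -/

theorem mainTheorem10 (a : ℕ) :
    -- (i) explicit formula, for `a ≥ 1`; the factor at the end is a falling factorial
    (1 ≤ a → ∀ (b c d l : ℝ) (T : ℕ → ℕ → ℝ), IsGenLahTriangle a b c d l T → ∀ n k : ℕ,
      HasSum
        (fun j : ℕ => (a : ℝ) ^ n / (k.factorial : ℝ) *
          ∑ i ∈ Finset.range (k + j + 1),
            (-1 : ℝ) ^ ((n : ℤ) + k + j - i) * b ^ ((n : ℤ) - k - j) * c ^ (k + j) * l ^ j /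
              (j.factorial : ℝ) * ((k + j).choose i : ℝ) *
              (descPochhammer ℝ n).eval (-((i + a * d) / a)))
        (T n k)) ∧
    -- (i) for `a = 0`, where `a ^ n (-(i + ad)/a)_n = ∏_{r < n} (-(i + ad) - r a)` is `(-i) ^ n`
    (a = 0 → ∀ (b c d l : ℝ) (T : ℕ → ℕ → ℝ), IsGenLahTriangle a b c d l T → ∀ n k : ℕ,
      HasSum
        (fun j : ℕ => 1 / (k.factorial : ℝ) *
          ∑ i ∈ Finset.range (k + j + 1),
            (-1 : ℝ) ^ ((n : ℤ) + k + j - i) * b ^ ((n : ℤ) - k - j) * c ^ (k + j) * l ^ j /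
              (j.factorial : ℝ) * ((k + j).choose i : ℝ) * (-(i : ℝ)) ^ n)
        (T n k)) ∧
    -- (ii) indeterminates `(b, l) = (X 0, X 1)`, constants `d ∈ ℕ`, `c > 0`
    (∀ (d : ℕ) (c : ℝ), 0 < c → ∀ T : ℕ → ℕ → MvPolynomial (Fin 2) ℝ,
      IsGenLahTriangle a (MvPolynomial.X 0) (MvPolynomial.C c) (d : MvPolynomial (Fin 2) ℝ)
        (MvPolynomial.X 1) T → IsXTP T) ∧
    -- (iii) `c = b`, indeterminates `(b, d, l) = (X 0, X 1, X 2)`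
    (∀ T : ℕ → ℕ → MvPolynomial (Fin 3) ℝ,
      IsGenLahTriangle a (MvPolynomial.X 0) (MvPolynomial.X 0) (MvPolynomial.X 1)
        (MvPolynomial.X 2) T → IsXTP T) ∧
    -- (iv) `c = b`, indeterminates `(b, d, l, q) = (X 0, X 1, X 2, X 3)`
    (∀ T : ℕ → ℕ → MvPolynomial (Fin 4) ℝ,
      IsGenLahTriangle a (MvPolynomial.X 0) (MvPolynomial.X 0) (MvPolynomial.X 1)
        (MvPolynomial.X 2) T →
        IsXSM (fun n => (rowPoly T n).eval (MvPolynomial.X 3)) ∧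
        IsXLogConvexOfOrder 3 (fun n => (rowPoly T n).eval (MvPolynomial.X 3))) ∧
    -- (iv) column `0`: indeterminates `(b, d, l) = (X 0, X 1, X 2)`
    (∀ T : ℕ → ℕ → MvPolynomial (Fin 3) ℝ,
      IsGenLahTriangle a (MvPolynomial.X 0) (MvPolynomial.X 0) (MvPolynomial.X 1)
        (MvPolynomial.X 2) T →
        IsXSM (fun n => T n 0) ∧ IsXLogConvexOfOrder 3 (fun n => T n 0)) ∧
    -- (v) `∑_{n ≥ 1} f_n t^n / n! = ((1 - a b t) ^ (-1/a) - 1) / b`, for `a ≥ 1`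
    (1 ≤ a → ∀ b : ℝ, 0 < b →
      ∀ f : ℕ → ℝ,
        PowerSeries.mk (fun n => if n = 0 then 0 else f n / (n.factorial : ℝ)) =
          PowerSeries.C b⁻¹ *
            (PowerSeries.rescale (-(a * b)) (PowerSeries.binomialSeries ℝ (-(1 / a) : ℝ)) - 1) →
        IsStieltjesMoment fun n => f (n + 1)) ∧
    -- (v) for `a = 0`, where the generating function is its limit `(exp (b t) - 1) / b`
    (a = 0 → ∀ b : ℝ, 0 < b →
      ∀ f : ℕ → ℝ,
        PowerSeries.mk (fun n => if n = 0 then 0 else f n / (n.factorial : ℝ)) =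
          PowerSeries.C b⁻¹ * (PowerSeries.rescale b (PowerSeries.exp ℝ) - 1) →
        IsStieltjesMoment fun n => f (n + 1)) ∧
    -- (vi)
    (∀ b d l : ℝ, 0 ≤ b → 0 ≤ d → 0 ≤ l → ∀ T : ℕ → ℕ → ℝ,
      IsGenLahTriangle a b b d l T → PreservesSM T) ∧
    -- (vii) `m = a + 1`, `d = 0`, `q` an indeterminate
    (∀ (m : ℕ) (b c l : ℝ) (T : ℕ → ℕ → ℝ), a + 1 = m → IsGenLahTriangle a b c 0 l T →
      IsBranchedSFraction m
        (branchedCoeffs m (Polynomial.C c * (Polynomial.X + Polynomial.C l)) (Polynomial.C b))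
        (PowerSeries.mk fun n => rowPoly T n)) ∧
    -- (vii) the case `q = 0`
    (∀ (m : ℕ) (b c l : ℝ) (T : ℕ → ℕ → ℝ), a + 1 = m → IsGenLahTriangle a b c 0 l T →
      IsBranchedSFraction m (branchedCoeffs m (c * l) b) (PowerSeries.mk fun n => T n 0)) ∧
    -- (viii) rows are PF, and (unless it vanishes identically) `T_n` has only real zeros
    (∀ b c d l : ℝ, 0 ≤ b → 0 ≤ c → 0 ≤ d → 0 ≤ l → ∀ T : ℕ → ℕ → ℝ,
      IsGenLahTriangle a b c d l T → ∀ n : ℕ,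
        IsPF (T n) ∧
        (rowPoly T n ≠ 0 → ∀ z : ℂ, Polynomial.aeval z (rowPoly T n) = 0 → z.im = 0)) := by
  refine ⟨fun ha b c d l T hT n k => ?_, fun ha b c d l T hT n k => ?_, fun d c hc T hT => ?_,
    fun T hT => ?_, fun T hT => ?_, fun T hT => ?_, fun ha b hb f hf => ?_, fun ha b hb f hf => ?_,
    fun b d l hb hd hl T hT => ?_, fun m b c l T hm hT => ?_, fun m b c l T hm hT => ?_,
    fun b c d l hb hc hd hl T hT n => ?_⟩
  · rw [hT.eq_coeff]
    exact hasSum_genLahPoly_coeff a b c d l n k _ _ fun i => pow_mul_eval_descPochhammer ha d n i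
  · subst ha
    rw [hT.eq_coeff]
    refine hasSum_genLahPoly_coeff 0 b c d l n k _ _ fun i => ?_
    simp [neg_pow (i : ℝ)]
  · exact hT.isXTP_of_C hc (X_mem_nonnegCoeffs 0) (X_mem_nonnegCoeffs 1)
  · exact hT.isXTP (X_mem_nonnegCoeffs 0) (X_mem_nonnegCoeffs 1) (X_mem_nonnegCoeffs 2)
  · simp only [hT.rowPoly_eq, eval_genLahPoly]
    exact isXSM_coeff_zero_genLahPoly a (X_mem_nonnegCoeffs 0) (X_mem_nonnegCoeffs 1)
      ((nonnegCoeffs (Fin 4)).add_mem (X_mem_nonnegCoeffs 2) (X_mem_nonnegCoeffs 3))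
  · simp only [hT.eq_coeff]
    exact isXSM_coeff_zero_genLahPoly a (X_mem_nonnegCoeffs 0) (X_mem_nonnegCoeffs 1)
      (X_mem_nonnegCoeffs 2)
  · rw [funext (eq_prod_of_mk_eq_binomialSeries ha hb hf)]
    exact isStieltjesMoment_prod (by positivity) (by positivity)
  · rw [funext (eq_pow_of_mk_eq_exp hb hf)]
    simpa using isStieltjesMoment_prod hb.le (le_refl (0 : ℝ))
  · rw [funext₂ hT.eq_coeff]
    exact preservesSM_genLahPoly hb hd hl
  · subst hm
    exact hT.isBranchedSFraction
  · subst hm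
    exact hT.isBranchedSFraction_column_zero
  · have hroots := hasNonposRoots_genLahPoly a hb hc hd hl n
    rw [hT.rowPoly_eq, funext (hT.eq_coeff n)]
    exact ⟨hroots.isPF, fun h0 z hz => hroots.im_eq_zero h0 hz⟩
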